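/- Let $G$ be a matrix Lie group (more generally, any finite-dimensional real Lie group) with identity $e$, Lie algebra $\mathfrak g=T_eG$, exponential map $\exp:\mathfrak g\to G$ and left translations $\Phi_q(h)=qh$. Let $N,n,m$ be natural numbers. For $t=0,\dots,N-1$ let $s_t:G\times\mathbb R^n\to G$, $f_t:G\times\mathbb R^n\times\mathbb R^m\to\mathbb R^n$ and $c_t:G\times\mathbb R^n\times\mathbb R^m\to\mathbb R$ be smooth maps and let $\mathbb U_t\subset\mathbb R^m$ be a convex set. Fix $(\bar q_0,\bar x_0),(\bar q_N,\bar x_N)\in G\times\mathbb R^n$ and consider the problem of minimizing $$\sum_{t=0}^{N-1}c_t(q_t,x_t,u_t)$$ subject to $q_{t+1}=q_ts_t(q_t,x_t)$, $x_{t+1}=f_t(q_t,x_t,u_t)$, $u_t\in\mathbb U_t$ for $t=0,\dots,N-1$, $(q_0,x_0)=(\bar q_0,\bar x_0)$ and $(q_N,x_N)=(\bar q_N,\bar x_N)$. Suppose that there is an open set $\mathcal O\subset\mathfrak g$ such that $\exp:\mathcal O\to\exp(\mathcal O)$ is a diffeomorphism onto an open subset of $G$ and such that $s_t(q_t,x_t)\in\exp(\mathcal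 O)$ for all $t=0,\dots,N-1$ along every trajectory that satisfies these constraints. Write $\exp^{-1}:\exp(\mathcal O)\to\mathcal O$ for the inverse and, for $\nu\in\mathbb R$, define the Hamiltonian $$H^\nu(t,\zeta,\xi,q,x,u)=\nu c_t(q,x,u)+\langle\zeta,\exp^{-1}(s_t(q,x))\rangle+\langle\xi,f_t(q,x,u)\rangle,\qquad \zeta\in\mathfrak g^*,\ \xi\in(\mathbb R^n)^*.$$ Let $(\mathring u_t)_{t=0}^{N-1}$ be an optimal controller, with corresponding state trajectory $(\mathring q_t,\mathring x_t)_{t=0}^{N}$. Then there exist $(\zeta^t,\xi^t)_{t=0}^{N-1}\subset\mathfrak g^*\times(\mathbb R^n)^*$ and $\nu\in\{-1,0\}$ such that, with $\gamma_t=(t,\zeta^t,\xi^t,\mathring q_t,\mathring x_t,\mathring u_t)$ and $$\rho^t=\Big(\mathcal D\exp^{-1}\big(e^{\mathcal D_\zeta H^\nu(\gamma_t)}\big)\circ T_e\Phi_{e^{\mathcal D_\zeta H^\nu(\gamma_t)}}\Big)^*(\zeta^t)\in\mathfrak g^*,$$ where $e^X=\exp(X)$, the following hold. (i) State and adjoint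 dynamics: for $t=0,\dots,N-1$, $$\mathring q_{t+1}=\mathring q_t\,e^{\mathcal D_\zeta H^\nu(\gamma_t)},\qquad \mathring x_{t+1}=\mathcal D_\xi H^\nu(\gamma_t),$$ and for $t=1,\dots,N-1$, $$\rho^{t-1}=\mathrm{Ad}^*_{e^{-\mathcal D_\zeta H^\nu(\gamma_t)}}\rho^t+T_e^*\Phi_{\mathring q_t}\big(\mathcal D_qH^\nu(\gamma_t)\big),\qquad \xi^{t-1}=\mathcal D_xH^\nu(\gamma_t),$$ where $\mathrm{Ad}_g^*$ is the dual map of $\mathrm{Ad}_g:\mathfrak g\to\mathfrak g$ and $\langle T_e^*\Phi_q(a),w\rangle=\langle a,T_e\Phi_q(w)\rangle$ for $a\in T_q^*G$, $w\in\mathfrak g$. (ii) Hamiltonian non-positive gradient condition: $\langle\mathcal D_uH^\nu(\gamma_t),w-\mathring u_t\rangle\le0$ for all $w\in\mathbb U_t$ and $t=0,\dots,N-1$. (iii) Non-triviality: $\nu$ and all the $\zeta^t,\xi^t$, $t=0,\dots,N-1$, do not vanish simultaneously. -/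

import Mathlib

open Set Function
open scoped Manifold ContDiff

noncomputable section

namespace LieOCP

/-- The Lie algebra `𝔤 = T₁G` of a Lie group `G` modelled on `E`. Mathlib's
`TangentSpace 𝓘(ℝ, E) (1 : G)` is the model space `E` by definition; this reducible name
makes the norm of `E` available on it. -/
abbrev LieAlg (E : Type*) [NormedAddCommGroup E] [NormedSpace ℝ E]
    (G : Type*) [TopologicalSpace G] [ChartedSpace E G] [Group G] : Type _ := E

section Group

variable {E : Type*} [NormedAddCommGroup E] [NormedSpace ℝ E]
  {G : Type*} [TopologicalSpace G] [ChartedSpace E G] [Group G]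

theorem lieAlg_eq_groupLieAlgebra : LieAlg E G = GroupLieAlgebra 𝓘(ℝ, E) G := rfl

/-- `γ : ℝ → G` is a one-parameter subgroup of `G` with velocity `X ∈ 𝔤` at `0`. -/
structure IsOneParameterSubgroup (X : LieAlg E G) (γ : ℝ → G) : Prop where
  map_zero : γ 0 = 1
  map_add : ∀ a b : ℝ, γ (a + b) = γ a * γ b
  hasMFDerivAt_zero : HasMFDerivAt 𝓘(ℝ, ℝ) 𝓘(ℝ, E) γ 0
    (ContinuousLinearMap.toSpanSingleton ℝ X : ℝ →L[ℝ] E)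

open Classical in
/-- The exponential map `𝔤 → G`: the value at time `1` of the one-parameter subgroup with
velocity `X`. (In a Lie group that subgroup exists and is unique, so that the `else` branch
is never used.) -/
def lieExp (X : LieAlg E G) : G :=
  if h : ∃ γ : ℝ → G, IsOneParameterSubgroup X γ then h.choose 1 else 1

/-- The inverse `exp(𝒪) → 𝒪` of the restriction of the exponential map to `𝒪 ⊆ 𝔤`
(an arbitrary value is taken outside `exp(𝒪)`). -/
def lieLog (O : Set (LieAlg E G)) : G → LieAlg E G :=
  invFunOn (lieExp : LieAlg E G → G) O

/-- `𝒪 ⊆ 𝔤` is open and `exp : 𝒪 → exp(𝒪)` is a (smooth) diffeomorphism onto an open subset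
of `G`. -/
structure IsExpDiffeoOn (O : Set (LieAlg E G)) : Prop where
  isOpen_source : IsOpen O
  injOn : InjOn (lieExp : LieAlg E G → G) O
  isOpen_target : IsOpen ((lieExp : LieAlg E G → G) '' O)
  contMDiffOn_exp : ContMDiffOn 𝓘(ℝ, E) 𝓘(ℝ, E) ∞ (lieExp : LieAlg E G → G) O
  contMDiffOn_log :
    ContMDiffOn 𝓘(ℝ, E) 𝓘(ℝ, E) ∞ (lieLog O : G → LieAlg E G) (lieExp '' O)

/-- The tangent map `T₁Φ_q : 𝔤 → T_q G` of the left translation `Φ_q h = q h`. -/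
def leftTangent (q : G) : LieAlg E G →L[ℝ] TangentSpace 𝓘(ℝ, E) q :=
  (mfderiv 𝓘(ℝ, E) 𝓘(ℝ, E) (fun h : G => q * h) 1 : E →L[ℝ] E)

/-- The cotangent left trivialization `T₁*Φ_q : T_q* G → 𝔤*`. -/
def leftTrivialization (q : G) (a : TangentSpace 𝓘(ℝ, E) q →L[ℝ] ℝ) :
    LieAlg E G →L[ℝ] ℝ :=
  a.comp (leftTangent q)

/-- The adjoint action `Ad_g : 𝔤 → 𝔤`, the tangent map at `1` of `h ↦ g h g⁻¹`. -/
def Ad (g : G) : LieAlg E G →L[ℝ] LieAlg E G :=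
  (mfderiv 𝓘(ℝ, E) 𝓘(ℝ, E) (fun h : G => g * h * g⁻¹) 1 : E →L[ℝ] E)

/-- The dual `Ad_g* : 𝔤* → 𝔤*` of `Ad_g`. -/
def AdDual (g : G) (a : LieAlg E G →L[ℝ] ℝ) : LieAlg E G →L[ℝ] ℝ :=
  a.comp (Ad g)

/-- The derivative `𝒟 exp⁻¹(g) : T_g G → 𝔤` of the local inverse of `exp`. -/
def derivLog (O : Set (LieAlg E G)) (g : G) :
    TangentSpace 𝓘(ℝ, E) g →L[ℝ] LieAlg E G :=
  (mfderiv 𝓘(ℝ, E) 𝓘(ℝ, E) (lieLog O : G → LieAlg E G) g : E →L[ℝ] E)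

/-- The map `(𝒟 exp⁻¹(g) ∘ T₁Φ_g)* : 𝔤* → 𝔤*`. -/
def coDerivLog (O : Set (LieAlg E G)) (g : G) (ζ : LieAlg E G →L[ℝ] ℝ) :
    LieAlg E G →L[ℝ] ℝ :=
  ζ.comp ((derivLog O g).comp (leftTangent g))

end Group

/-- The vector of a finite-dimensional space `V` that represents a given element of its
bidual: `φ (ofBidual Λ) = Λ φ` for all `φ ∈ V*`. -/
def ofBidual {V : Type*} [NormedAddCommGroup V] [NormedSpace ℝ V] [FiniteDimensional ℝ V]
    (Λ : (V →L[ℝ] ℝ) →L[ℝ] ℝ) : V :=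
  (Module.evalEquiv ℝ V).symm
    (Λ.toLinearMap ∘ₗ (LinearMap.toContinuousLinearMap (𝕜 := ℝ) (E := V) (F' := ℝ)).toLinearMap)

theorem apply_ofBidual {V : Type*} [NormedAddCommGroup V] [NormedSpace ℝ V]
    [FiniteDimensional ℝ V] (Λ : (V →L[ℝ] ℝ) →L[ℝ] ℝ) (φ : V →L[ℝ] ℝ) :
    φ (ofBidual Λ) = Λ φ := by
  have h := Module.apply_evalEquiv_symm_apply ℝ V φ.toLinearMap
    (Λ.toLinearMap ∘ₗ
      (LinearMap.toContinuousLinearMap (𝕜 := ℝ) (E := V) (F' := ℝ)).toLinearMap)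
  exact h

section Problem

variable {E : Type*} [NormedAddCommGroup E] [NormedSpace ℝ E]
  {G : Type*} [TopologicalSpace G] [ChartedSpace E G] [Group G]
  {X V : Type*} [NormedAddCommGroup X] [NormedSpace ℝ X]
  [NormedAddCommGroup V] [NormedSpace ℝ V]

/-- `((q_t, x_t)_{t ≤ N}, (u_t)_{t < N})` is a state-action trajectory of the system
`q_{t+1} = q_t s_t(q_t, x_t)`, `x_{t+1} = f_t(q_t, x_t, u_t)` that satisfies the control
constraints `u_t ∈ U_t` and goes from `(q₀, x₀)` to `(q_N, x_N)`. Only the values of the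
sequences at the times `t ≤ N` (`t < N` for `u`) play a role. -/
structure IsAdmissible (N : ℕ) (s : ℕ → G → X → G) (f : ℕ → G → X → V → X)
    (U : ℕ → Set V) (q₀ : G) (x₀ : X) (q_N : G) (x_N : X)
    (q : ℕ → G) (x : ℕ → X) (u : ℕ → V) : Prop where
  dyn_q : ∀ t < N, q (t + 1) = q t * s t (q t) (x t)
  dyn_x : ∀ t < N, x (t + 1) = f t (q t) (x t) (u t)
  control : ∀ t < N, u t ∈ U t
  init_q : q 0 = q₀
  init_x : x 0 = x₀
  final_q : q N = q_N
  final_x : x N = x_N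

/-- The performance index `∑_{t < N} c_t(q_t, x_t, u_t)`. -/
def cost (N : ℕ) (c : ℕ → G → X → V → ℝ) (q : ℕ → G) (x : ℕ → X) (u : ℕ → V) : ℝ :=
  ∑ t ∈ Finset.range N, c t (q t) (x t) (u t)

/-- An optimal state-action trajectory: an admissible one of least cost. -/
structure IsOptimal (N : ℕ) (s : ℕ → G → X → G) (f : ℕ → G → X → V → X)
    (c : ℕ → G → X → V → ℝ) (U : ℕ → Set V) (q₀ : G) (x₀ : X) (q_N : G) (x_N : X)
    (q : ℕ → G) (x : ℕ → X) (u : ℕ → V) : Prop where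
  admissible : IsAdmissible N s f U q₀ x₀ q_N x_N q x u
  cost_le : ∀ (q' : ℕ → G) (x' : ℕ → X) (u' : ℕ → V),
    IsAdmissible N s f U q₀ x₀ q_N x_N q' x' u' → cost N c q x u ≤ cost N c q' x' u'

/-- The Hamiltonian
`H^ν(τ, ζ, ξ, q, x, u) = ν c_τ(q, x, u) + ⟨ζ, exp⁻¹(s_τ(q, x))⟩ + ⟨ξ, f_τ(q, x, u)⟩`. -/
def hamiltonian (O : Set (LieAlg E G)) (s : ℕ → G → X → G) (f : ℕ → G → X → V → X)
    (c : ℕ → G → X → V → ℝ) (ν : ℝ)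
    (τ : ℕ) (ζ : LieAlg E G →L[ℝ] ℝ) (ξ : X →L[ℝ] ℝ) (q : G) (x : X) (u : V) : ℝ :=
  ν * c τ q x u + ζ (lieLog O (s τ q x)) + ξ (f τ q x u)

/-! Partial derivatives of a function `H` of `(τ, ζ, ξ, q, x, u)`; those in the covectors
`ζ ∈ 𝔤*` and `ξ ∈ X*` are regarded as elements of `𝔤` and `X`. -/

def Dζ [FiniteDimensional ℝ E]
    (H : ℕ → (LieAlg E G →L[ℝ] ℝ) → (X →L[ℝ] ℝ) → G → X → V → ℝ)
    (τ : ℕ) (ζ : LieAlg E G →L[ℝ] ℝ) (ξ : X →L[ℝ] ℝ) (q : G) (x : X) (u : V) : LieAlg E G :=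
  ofBidual (V := LieAlg E G) (fderiv ℝ (fun ζ' => H τ ζ' ξ q x u) ζ)

def Dξ [FiniteDimensional ℝ X]
    (H : ℕ → (LieAlg E G →L[ℝ] ℝ) → (X →L[ℝ] ℝ) → G → X → V → ℝ)
    (τ : ℕ) (ζ : LieAlg E G →L[ℝ] ℝ) (ξ : X →L[ℝ] ℝ) (q : G) (x : X) (u : V) : X :=
  ofBidual (V := X) (fderiv ℝ (fun ξ' => H τ ζ ξ' q x u) ξ)

def Dq (H : ℕ → (LieAlg E G →L[ℝ] ℝ) → (X →L[ℝ] ℝ) → G → X → V → ℝ)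
    (τ : ℕ) (ζ : LieAlg E G →L[ℝ] ℝ) (ξ : X →L[ℝ] ℝ) (q : G) (x : X) (u : V) :
    TangentSpace 𝓘(ℝ, E) q →L[ℝ] ℝ :=
  (mfderiv 𝓘(ℝ, E) 𝓘(ℝ, ℝ) (fun q' => H τ ζ ξ q' x u) q : E →L[ℝ] ℝ)

def Dx (H : ℕ → (LieAlg E G →L[ℝ] ℝ) → (X →L[ℝ] ℝ) → G → X → V → ℝ)
    (τ : ℕ) (ζ : LieAlg E G →L[ℝ] ℝ) (ξ : X →L[ℝ] ℝ) (q : G) (x : X) (u : V) : X →L[ℝ] ℝ :=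
  fderiv ℝ (fun x' => H τ ζ ξ q x' u) x

def Du (H : ℕ → (LieAlg E G →L[ℝ] ℝ) → (X →L[ℝ] ℝ) → G → X → V → ℝ)
    (τ : ℕ) (ζ : LieAlg E G →L[ℝ] ℝ) (ξ : X →L[ℝ] ℝ) (q : G) (x : X) (u : V) : V →L[ℝ] ℝ :=
  fderiv ℝ (fun u' => H τ ζ ξ q x u') u

end Problem

end LieOCP

end

open LieOCP

/-!
Since the states are determined by the controls, the problem is the minimization of a smooth
function of `w = (u_0, …, u_{N-1})` over the convex set `∏ U_t`, subject to the finitely many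
equality constraints `(q_N(w), x_N(w)) = (q_N, x_N)`; the one on `q_N` is read in a chart centred at
the endpoint, in which the derivative is the manifold derivative.

The Fritz John rule `exists_multiplier_of_local_min` gives `ν ∈ {-1, 0}` and multipliers `(p, π)` of
the endpoint constraints, not all zero, such that `ν J' + p Q_N' + π X_N'` is nonpositive in all
directions pointing into `∏ U_t`. It comes from separating `0` from the convex set of first-order
variations of cost and endpoint. Such a separation exists as soon as `0` is not an interior point,
and if it were one, the open mapping theorem on convex sets `nhds_le_map_nhdsWithin_of_convex` would
produce admissible controls of smaller cost. The sets `U_t` need not be closed, nor have interior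
points.

The covectors `(p, π)` at the endpoint are transported backwards along the linearized dynamics. With
`P t = (p_t, π_t)` a covector at `(q_t, x_t)`, the recursion is `p_t = p_{t+1} ∘ T R_{s_t} + D_q H`,
`π_t = D_x H`, with `R` the right translation. The multiplier `ζ^t` is `p_{t+1}` pulled back to `𝔤`
along `T Φ_{q_t} ∘ D exp`, so that `ρ^t` is `p_{t+1}` read in the left trivialization at `q_{t+1}`
(`coDerivLog_pullbackCovector`). The coadjoint term in the recursion for `ρ` is the derivative of the
identity `q s (s⁻¹ h s) = (q h) s` (`leftTangent_comp_Ad_inv`), together with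
`exp (-X) = (exp X)⁻¹` (`lieExp_neg`), which rests on the uniqueness of one-parameter subgroups.

By `adjoint_step` the pairing of costate and state variation changes from `t` to `t + 1` exactly by
`D_u H`, up to the running cost, so the first variation of the reduced problem is the sum of the
`D_u H` (`IsAdmissible.sum_Du_hamiltonian`), and varying one control at a time gives the gradient
condition. Nontriviality holds because `p ↦ ζ^{N-1}` is injective.
-/

namespace LieOCP

open Filter Topology

/-! ### Convex separation and the Fritz John multiplier rule -/

/-- In finite dimensions a convex set that does not contain `0` in its interior lies in a closed
half-space `{y | g y ≤ 0}`, `g ≠ 0`; no assumption on the interior being nonempty is needed. -/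
theorem exists_ne_zero_forall_le_zero {P : Type*} [NormedAddCommGroup P] [NormedSpace ℝ P]
    [FiniteDimensional ℝ P] {S : Set P} (hS : Convex ℝ S) (h0 : (0 : P) ∈ S)
    (hint : (0 : P) ∉ interior S) : ∃ g : P →L[ℝ] ℝ, g ≠ 0 ∧ ∀ y ∈ S, g y ≤ 0 := by
  by_cases hne : (interior S).Nonempty
  · obtain ⟨g, hg, hle⟩ := geometric_hahn_banach_of_nonempty_interior_point hS hint hne
    exact ⟨g, hg, by simpa using hle⟩
  · have hspan : Submodule.span ℝ S < ⊤ := by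
      refine lt_top_iff_ne_top.2 fun h => hne ?_
      rw [hS.interior_nonempty_iff_affineSpan_eq_top,
        ← AffineSubspace.direction_eq_top_iff_of_nonempty ⟨0, subset_affineSpan ℝ S h0⟩,
        direction_affineSpan, vectorSpan_eq_span_vsub_set_right ℝ h0]
      simpa using h
    obtain ⟨g, hg, hle⟩ := Submodule.exists_le_ker_of_lt_top _ hspan
    refine ⟨LinearMap.toContinuousLinearMap g, fun h => hg ?_, fun y hy => ?_⟩
    · ext y
      simpa using DFunLike.congr_fun h y
    · exact le_of_eq (hle (Submodule.subset_span hy))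

/-- An open mapping theorem on convex sets: if `0` is interior to `A(D - z₀)`, where `A` is the
strict derivative of `Φ` at `z₀ ∈ D`, then `Φ` maps neighbourhoods of `z₀` in `D` to
neighbourhoods of `Φ z₀`. -/
theorem nhds_le_map_nhdsWithin_of_convex {W P : Type*} [NormedAddCommGroup W] [NormedSpace ℝ W]
    [NormedAddCommGroup P] [NormedSpace ℝ P] [FiniteDimensional ℝ P] {Φ : W → P} {A : W →L[ℝ] P}
    {z₀ : W} (hΦ : HasStrictFDerivAt Φ A z₀) {D : Set W} (hD : Convex ℝ D) (hz : z₀ ∈ D)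
    (h0 : (0 : P) ∈ interior ((fun w => A (w - z₀)) '' D)) :
    𝓝 (Φ z₀) ≤ map Φ (𝓝[D] z₀) := by
  set S : Set P := (fun w => A (w - z₀)) '' D with hS
  have hS0 : S ∈ 𝓝 (0 : P) := mem_interior_iff_mem_nhds.1 h0
  let b := Module.finBasis ℝ P
  have key : ∀ j, ∃ c : ℝ, 0 < c ∧ c • b j ∈ S ∧ (-c) • b j ∈ S := by
    intro j
    have h1 : Tendsto (fun c : ℝ => c • b j) (𝓝 0) (𝓝 0) := by
      have : Continuous fun c : ℝ => c • b j := by fun_prop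
      simpa using this.tendsto 0
    have h2 : Tendsto (fun c : ℝ => (-c) • b j) (𝓝 0) (𝓝 0) := by
      have : Continuous fun c : ℝ => (-c) • b j := by fun_prop
      simpa using this.tendsto 0
    have h3 : ∀ᶠ c in 𝓝[>] (0 : ℝ), c • b j ∈ S ∧ (-c) • b j ∈ S :=
      ((h1.eventually hS0).and (h2.eventually hS0)).filter_mono nhdsWithin_le_nhds
    obtain ⟨c, hc, hc0⟩ := (h3.and self_mem_nhdsWithin).exists
    exact ⟨c, hc0, hc⟩
  choose c hc0 hcp hcm using key
  choose wp hwpD hwp using hcp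
  choose wm hwmD hwm using hcm
  -- the points `w i` of `D` have derivatives `± c j • b j`, which sum to zero and span `P`
  let ι := Fin (Module.finrank ℝ P) ⊕ Fin (Module.finrank ℝ P)
  let w : ι → W := Sum.elim wp wm
  have hwD : ∀ i, w i ∈ D := by rintro (j | j) <;> simp [w, hwpD, hwmD]
  let L : (ι → ℝ) →L[ℝ] W :=
    LinearMap.toContinuousLinearMap (Fintype.linearCombination ℝ fun i => w i - z₀)
  have hL : ∀ a, L a = ∑ i, a i • (w i - z₀) := fun a => by
    simp [L, Fintype.linearCombination_apply]
  have hAL1 : ∀ ε : ℝ, A (L fun _ => ε) = 0 := by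
    intro ε
    rw [hL, Fintype.sum_sum_type, map_add, map_sum, map_sum, ← Finset.sum_add_distrib]
    refine Finset.sum_eq_zero fun j _ => ?_
    have h1 : A (wp j - z₀) = c j • b j := hwp j
    have h2 : A (wm j - z₀) = (-c j) • b j := hwm j
    simp only [w, Sum.elim_inl, Sum.elim_inr, map_smul]
    rw [h1, h2, ← smul_add, ← add_smul]
    simp
  have hsurj : (A.comp L).range = ⊤ := by
    rw [eq_top_iff, ← b.span_eq, Submodule.span_le]
    rintro _ ⟨j, rfl⟩
    refine ⟨Pi.single (Sum.inl j) (c j)⁻¹, ?_⟩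
    have h1 := hwp j
    simp only at h1
    have : L (Pi.single (Sum.inl j) (c j)⁻¹) = (c j)⁻¹ • (wp j - z₀) := by
      rw [hL, Finset.sum_eq_single (Sum.inl j)]
      · simp [w]
      · intro i _ hi
        simp [Pi.single_eq_of_ne hi]
      · simp
    change A (L _) = _
    rw [this, map_smul, h1, smul_smul, inv_mul_cancel₀ (hc0 j).ne', one_smul]
  let Ψ : (ι → ℝ) → P := fun a => Φ (z₀ + L a)
  have hΨ : HasStrictFDerivAt Ψ (A.comp L) 0 := by
    refine HasStrictFDerivAt.comp (g := Φ) (f := fun a => z₀ + L a) 0 ?_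
      (L.hasStrictFDerivAt.const_add z₀)
    simpa using hΦ
  let R := (A.comp L).nonlinearRightInverseOfSurjective hsurj
  have hRpos : 0 < R.nnnorm := (A.comp L).nonlinearRightInverseOfSurjective_nnnorm_pos hsurj
  -- with `k = ‖R‖⁻¹ / 3` the ball that `Ψ` covers has radius `2 k ε`, while its centre is
  -- within `k ε` of `Φ z₀`
  obtain ⟨s, hs, happ⟩ := hΨ.approximates_deriv_on_nhds (c := R.nnnorm⁻¹ / 3)
    (Or.inr (by positivity))
  intro T hT
  rw [mem_map, mem_nhdsWithin_iff_exists_mem_nhds_inter] at hT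
  obtain ⟨N, hN, hNT⟩ := hT
  have hN' : (fun a => z₀ + L a) ⁻¹' N ∈ 𝓝 (0 : ι → ℝ) := by
    have : ContinuousAt (fun a => z₀ + L a) 0 := by fun_prop
    exact this.preimage_mem_nhds (by simpa using hN)
  obtain ⟨δ, hδ, hball⟩ := Metric.nhds_basis_closedBall.mem_iff.1 (inter_mem hs hN')
  set n : ℝ := (Fintype.card ι : ℝ) with hn
  have hn0 : 0 ≤ n := by positivity
  let ε : ℝ := min (δ / 2) (1 / (2 * (n + 1)))
  have hε : 0 < ε := by positivity
  have hε1 : 2 * ε ≤ δ := by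
    have := min_le_left (δ / 2) (1 / (2 * (n + 1)))
    linarith
  have hε2 : n * (2 * ε) ≤ 1 := by
    have h : ε ≤ 1 / (2 * (n + 1)) := min_le_right _ _
    rw [le_div_iff₀ (by positivity)] at h
    nlinarith
  let o : ι → ℝ := fun _ => ε
  have hcoord : ∀ a ∈ Metric.closedBall o ε, ∀ i, 0 ≤ a i ∧ a i ≤ 2 * ε := by
    intro a ha i
    have h1 : dist (a i) ε ≤ ε := (dist_le_pi_dist a o i).trans ha
    rw [Real.dist_eq, abs_le] at h1
    constructor <;> linarith
  have hsub : Metric.closedBall o ε ⊆ Metric.closedBall 0 δ := by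
    intro a ha
    rw [mem_closedBall_zero_iff, pi_norm_le_iff_of_nonneg hδ.le]
    intro i
    rw [Real.norm_eq_abs, abs_of_nonneg (hcoord a ha i).1]
    exact (hcoord a ha i).2.trans hε1
  have hmem : ∀ a ∈ Metric.closedBall o ε, z₀ + L a ∈ D := by
    intro a ha
    have hsum : ∑ i, a i ≤ 1 := by
      calc ∑ i, a i ≤ ∑ _i : ι, 2 * ε := Finset.sum_le_sum fun i _ => (hcoord a ha i).2
        _ ≤ 1 := by simpa [hn] using hε2
    have h := hD.sum_mem (t := Finset.univ)
      (w := fun i : Option ι => i.elim (1 - ∑ i, a i) a) (z := fun i => i.elim z₀ w) ?_ ?_ ?_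
    · convert h using 1
      rw [Fintype.sum_option, hL]
      simp only [Option.elim, smul_sub, Finset.sum_sub_distrib, ← Finset.sum_smul, sub_smul,
        one_smul]
      abel
    · rintro (_ | i) _
      · simpa using hsum
      · exact (hcoord a ha i).1
    · simp [Fintype.sum_option]
    · rintro (_ | i) _
      · exact hz
      · exact hwD i
  have hcov := happ.surjOn_closedBall_of_nonlinearRightInverse R hε.le
    (hsub.trans (hball.trans inter_subset_left))
  have hclose : dist (Φ z₀) (Ψ o) ≤ (R.nnnorm⁻¹ / 3 : NNReal) * ε := by
    have h0s : (0 : ι → ℝ) ∈ s := mem_of_mem_nhds hs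
    have hos : o ∈ s := (hball (hsub (Metric.mem_closedBall_self hε.le))).1
    have h1 := happ o hos 0 h0s
    have h2 : A.comp L (o - 0) = 0 := by simpa using hAL1 ε
    have h3 : ‖o - 0‖ ≤ ε := by
      rw [sub_zero, pi_norm_le_iff_of_nonneg hε.le]
      intro i
      simp [o, abs_of_pos hε]
    have h4 : Ψ 0 = Φ z₀ := by simp [Ψ]
    rw [h2, sub_zero, h4] at h1
    rw [dist_comm, dist_eq_norm]
    exact h1.trans (by gcongr)
  have hnhds : Metric.closedBall (Ψ o) (((R.nnnorm : ℝ)⁻¹ - (R.nnnorm⁻¹ / 3 : NNReal)) * ε)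
      ∈ 𝓝 (Φ z₀) := by
    refine Metric.closedBall_mem_nhds_of_mem ?_
    rw [Metric.mem_ball]
    refine hclose.trans_lt ?_
    push_cast
    have : 0 < (R.nnnorm : ℝ)⁻¹ * ε := by positivity
    nlinarith
  refine mem_of_superset hnhds fun y hy => ?_
  obtain ⟨a, ha, rfl⟩ := hcov hy
  exact hNT ⟨(hball (hsub ha)).2, hmem a ha⟩

/-- The Fritz John rule for a local minimum of `J` on `{z ∈ C | F z = F z₀}`, with `C` an
arbitrary convex set and finitely many equality constraints. -/
theorem exists_multiplier_of_local_min {W Y : Type*} [NormedAddCommGroup W] [NormedSpace ℝ W]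
    [NormedAddCommGroup Y] [NormedSpace ℝ Y] [FiniteDimensional ℝ Y] {C : Set W}
    (hC : Convex ℝ C) {z₀ : W} (hz : z₀ ∈ C) {J : W → ℝ} {F : W → Y} {J' : W →L[ℝ] ℝ}
    {F' : W →L[ℝ] Y} (hJ : HasStrictFDerivAt J J' z₀) (hF : HasStrictFDerivAt F F' z₀)
    (hmin : ∀ᶠ z in 𝓝 z₀, z ∈ C → F z = F z₀ → J z₀ ≤ J z) :
    ∃ (ν : ℝ) (l : Y →L[ℝ] ℝ), (ν = -1 ∨ ν = 0) ∧ ¬ (ν = 0 ∧ l = 0) ∧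
      ∀ w ∈ C, ν * J' (w - z₀) + l (F' (w - z₀)) ≤ 0 := by
  -- the slack variable `r ≥ 0` makes the set of attainable values closed under raising the cost
  let Φ : W × ℝ → ℝ × Y := fun z => (J z.1 + z.2, F z.1)
  let A : W × ℝ →L[ℝ] ℝ × Y :=
    (J'.comp (.fst ℝ W ℝ) + .snd ℝ W ℝ).prod (F'.comp (.fst ℝ W ℝ))
  have hΦ : HasStrictFDerivAt Φ A (z₀, 0) :=
    ((hJ.comp (z₀, (0 : ℝ)) hasStrictFDerivAt_fst).add hasStrictFDerivAt_snd).prodMk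
      (hF.comp (z₀, (0 : ℝ)) hasStrictFDerivAt_fst)
  let D : Set (W × ℝ) := C ×ˢ Ici 0
  have hD : Convex ℝ D := hC.prod (convex_Ici 0)
  have hzD : (z₀, (0 : ℝ)) ∈ D := ⟨hz, self_mem_Ici⟩
  let S : Set (ℝ × Y) := (fun w => A (w - (z₀, 0))) '' D
  have hSconv : Convex ℝ S := by
    have h : S = A '' ((fun w => w - (z₀, (0 : ℝ))) '' D) := by simp only [S, image_image]
    rw [h]
    refine Convex.is_linear_image ?_ A.toLinearMap.isLinear
    simpa [sub_eq_add_neg] using hD.add (convex_singleton (-(z₀, (0 : ℝ))))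
  have hS0 : (0 : ℝ × Y) ∈ S := ⟨_, hzD, by simp⟩
  have hint : (0 : ℝ × Y) ∉ interior S := by
    intro h0
    have hle := nhds_le_map_nhdsWithin_of_convex hΦ hD hzD h0
    have hev : ∀ᶠ y in 𝓝 (Φ (z₀, 0)), y.2 = F z₀ → J z₀ ≤ y.1 := by
      have h1 : Tendsto Prod.fst (𝓝[D] (z₀, (0 : ℝ))) (𝓝 z₀) :=
        (continuous_fst.tendsto' _ _ rfl).mono_left nhdsWithin_le_nhds
      refine Eventually.filter_mono hle (eventually_map.2 ?_)
      filter_upwards [h1.eventually hmin, self_mem_nhdsWithin] with z hz hzD hFz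
      have := hz hzD.1 hFz
      have h2 : (0 : ℝ) ≤ z.2 := hzD.2
      change J z₀ ≤ J z.1 + z.2
      linarith
    have hcont : Tendsto (fun r : ℝ => (J z₀ - r, F z₀)) (𝓝[>] 0) (𝓝 (Φ (z₀, 0))) := by
      have : Continuous fun r : ℝ => (J z₀ - r, F z₀) := by fun_prop
      exact (this.tendsto' 0 _ (by simp [Φ])).mono_left nhdsWithin_le_nhds
    obtain ⟨r, hr, hr0⟩ := ((hcont.eventually hev).and self_mem_nhdsWithin).exists
    have h3 := hr rfl
    have h4 : (0 : ℝ) < r := hr0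
    simp only at h3
    linarith
  obtain ⟨g, hg, hgS⟩ := exists_ne_zero_forall_le_zero hSconv hS0 hint
  let a : ℝ := g (1, 0)
  let l : Y →L[ℝ] ℝ := g.comp (.inr ℝ ℝ Y)
  have hgal : ∀ r y, g (r, y) = a * r + l y := by
    intro r y
    have : (r, y) = r • ((1 : ℝ), (0 : Y)) + (0, y) := by simp
    rw [this, map_add, map_smul, smul_eq_mul, mul_comm]
    rfl
  have hineq : ∀ w ∈ C, ∀ r : ℝ, 0 ≤ r → a * (J' (w - z₀) + r) + l (F' (w - z₀)) ≤ 0 := by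
    intro w hw r hr
    have := hgS _ ⟨(w, r), ⟨hw, hr⟩, rfl⟩
    simpa [A, hgal] using this
  have ha : a ≤ 0 := by simpa using hineq z₀ hz 1 zero_le_one
  rcases ha.lt_or_eq with ha | ha
  · refine ⟨-1, (-a)⁻¹ • l, Or.inl rfl, by simp, fun w hw => ?_⟩
    have h1 := hineq w hw 0 le_rfl
    have h2 : -1 * J' (w - z₀) + ((-a)⁻¹ • l) (F' (w - z₀))
        = (-a)⁻¹ * (a * (J' (w - z₀) + 0) + l (F' (w - z₀))) := by
      have : a ≠ 0 := ha.ne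
      simp only [smul_apply, smul_eq_mul]
      field_simp
      ring
    rw [h2]
    exact mul_nonpos_of_nonneg_of_nonpos (inv_nonneg.2 (by linarith)) h1
  · refine ⟨0, l, Or.inr rfl, fun h => hg ?_, fun w hw => ?_⟩
    · ext y
      · simpa using ha
      · exact DFunLike.congr_fun h.2 y
    · have h1 := hineq w hw 0 le_rfl
      rw [ha] at h1
      simpa using h1

/-! ### Derivatives of translations and of the exponential map -/

section Group

variable {E : Type*} [NormedAddCommGroup E] [NormedSpace ℝ E]
  {G : Type*} [TopologicalSpace G] [ChartedSpace E G] [Group G]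

theorem mdifferentiable_mul_left [LieGroup 𝓘(ℝ, E) ∞ G] (g : G) :
    MDifferentiable 𝓘(ℝ, E) 𝓘(ℝ, E) (fun h : G => g * h) :=
  (contMDiff_mul_left (I := 𝓘(ℝ, E)) (n := ∞) (a := g)).mdifferentiable (by simp)

theorem mdifferentiable_mul_right [LieGroup 𝓘(ℝ, E) ∞ G] (g : G) :
    MDifferentiable 𝓘(ℝ, E) 𝓘(ℝ, E) (fun h : G => h * g) :=
  (contMDiff_mul_right (I := 𝓘(ℝ, E)) (n := ∞) (a := g)).mdifferentiable (by simp)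

variable (E) in
/-- The tangent map `T_hΦ_g` of the left translation by `g` at an arbitrary point `h`, as an
endomorphism of the model space. -/
noncomputable def mulLeftTangent (g h : G) : E →L[ℝ] E :=
  mfderiv 𝓘(ℝ, E) 𝓘(ℝ, E) (fun k : G => g * k) h

variable (E) in
/-- The tangent map at `h` of the right translation by `g`, as an endomorphism of the model
space. -/
noncomputable def mulRightTangent (g h : G) : E →L[ℝ] E :=
  mfderiv 𝓘(ℝ, E) 𝓘(ℝ, E) (fun k : G => k * g) h

theorem mulLeftTangent_mul [LieGroup 𝓘(ℝ, E) ∞ G] (a b h : G) :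
    mulLeftTangent E (a * b) h = (mulLeftTangent E a (b * h)).comp (mulLeftTangent E b h) := by
  have h1 := mfderiv_comp h (mdifferentiable_mul_left (E := E) a (b * h))
    (mdifferentiable_mul_left (E := E) b h)
  have h2 : (fun k : G => a * k) ∘ (fun k : G => b * k) = fun k => a * b * k := by
    ext k; simp [mul_assoc]
  rw [h2] at h1
  exact h1

theorem mulLeftTangent_one (h : G) :
    mulLeftTangent E (1 : G) h = ContinuousLinearMap.id ℝ E := by
  have h2 : (fun k : G => 1 * k) = id := by ext k; simp
  unfold mulLeftTangent
  rw [h2]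
  exact mfderiv_id

theorem leftTangent_mul [LieGroup 𝓘(ℝ, E) ∞ G] (a b : G) :
    (leftTangent (E := E) (a * b) : E →L[ℝ] E) =
      (mulLeftTangent E a b).comp (leftTangent (E := E) b : E →L[ℝ] E) := by
  have h := mulLeftTangent_mul (E := E) a b 1
  rw [mul_one] at h
  exact h

theorem eq_zero_of_comp_mulLeftTangent [LieGroup 𝓘(ℝ, E) ∞ G] {p : E →L[ℝ] ℝ} {g h : G}
    (hp : p.comp (mulLeftTangent E g h) = 0) : p = 0 := by
  have h1 := mulLeftTangent_mul (E := E) g g⁻¹ (g * h)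
  rw [mul_inv_cancel, mulLeftTangent_one, inv_mul_cancel_left] at h1
  rw [← p.comp_id, h1, ← ContinuousLinearMap.comp_assoc, hp, ContinuousLinearMap.zero_comp]

/-- The infinitesimal form of `q s (s⁻¹ h s) = (q h) s`. -/
theorem leftTangent_comp_Ad_inv [LieGroup 𝓘(ℝ, E) ∞ G] (q s : G) :
    (leftTangent (E := E) (q * s) : E →L[ℝ] E).comp (Ad s⁻¹) =
      (mulRightTangent E s q).comp (leftTangent (E := E) q : E →L[ℝ] E) := by
  have hconj : MDifferentiableAt 𝓘(ℝ, E) 𝓘(ℝ, E) (fun h : G => s⁻¹ * h * s⁻¹⁻¹) 1 :=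
    ((contMDiff_mul_right (I := 𝓘(ℝ, E)) (n := ∞) (a := s⁻¹⁻¹)).comp
      (contMDiff_mul_left (I := 𝓘(ℝ, E)) (n := ∞) (a := s⁻¹))).mdifferentiableAt (by simp)
  have h1 : HasMFDerivAt 𝓘(ℝ, E) 𝓘(ℝ, E) (fun k : G => q * s * k) (s⁻¹ * 1 * s⁻¹⁻¹)
      (leftTangent (E := E) (q * s)) := by
    have := (mdifferentiable_mul_left (E := E) (q * s) 1).hasMFDerivAt
    have e : s⁻¹ * 1 * s⁻¹⁻¹ = 1 := by simp
    rw [e]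
    exact this
  have h2 : HasMFDerivAt 𝓘(ℝ, E) 𝓘(ℝ, E) (fun k : G => k * s) (q * 1) (mulRightTangent E s q) := by
    have := (mdifferentiable_mul_right (E := E) s q).hasMFDerivAt
    rw [mul_one]
    exact this
  have h4 := HasMFDerivAt.comp (1 : G) h1 hconj.hasMFDerivAt
  have h5 := HasMFDerivAt.comp (f := fun k : G => q * k) (1 : G) h2
    (mdifferentiable_mul_left (E := E) q 1).hasMFDerivAt
  have h3 : (fun k : G => q * s * k) ∘ (fun h : G => s⁻¹ * h * s⁻¹⁻¹)
      = (fun k : G => k * s) ∘ (fun k : G => q * k) := by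
    ext k; simp [mul_assoc]
  rw [h3] at h4
  exact hasMFDerivAt_unique (f := (fun k : G => k * s) ∘ fun k : G => q * k) h4 h5

theorem IsOneParameterSubgroup.neg {X : LieAlg E G} {γ : ℝ → G}
    (h : IsOneParameterSubgroup X γ) : IsOneParameterSubgroup (-X) fun t => γ (-t) where
  map_zero := by simpa using h.map_zero
  map_add a b := by rw [neg_add, h.map_add]
  hasMFDerivAt_zero := by
    have h1 : HasMFDerivAt 𝓘(ℝ, ℝ) 𝓘(ℝ, ℝ) (fun t : ℝ => -t) 0 (-ContinuousLinearMap.id ℝ ℝ) :=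
      (hasFDerivAt_id (0 : ℝ)).neg.hasMFDerivAt
    have h2 := h.hasMFDerivAt_zero
    rw [← neg_zero] at h2
    have h3 := HasMFDerivAt.comp (0 : ℝ) h2 h1
    refine h3.congr_mfderiv ?_
    ext
    change (-1 : ℝ) • X = (1 : ℝ) • (-X)
    simp

theorem IsOneParameterSubgroup.isMIntegralCurve [LieGroup 𝓘(ℝ, E) ∞ G] {X : LieAlg E G}
    {γ : ℝ → G} (h : IsOneParameterSubgroup X γ) :
    IsMIntegralCurve (I := 𝓘(ℝ, E)) γ
      (mulInvariantVectorField (I := 𝓘(ℝ, E)) (X : GroupLieAlgebra 𝓘(ℝ, E) G)) := by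
  intro t
  have h1 : HasMFDerivAt 𝓘(ℝ, ℝ) 𝓘(ℝ, ℝ) (fun r : ℝ => r - t) t (ContinuousLinearMap.id ℝ ℝ) :=
    ((hasFDerivAt_id t).sub_const t).hasMFDerivAt
  have h2 := h.hasMFDerivAt_zero
  rw [← sub_self t] at h2
  have h3 := HasMFDerivAt.comp (f := fun r : ℝ => r - t) t h2 h1
  have h4 : HasMFDerivAt 𝓘(ℝ, E) 𝓘(ℝ, E) (fun k : G => γ t * k) (γ (t - t))
      (mulLeftTangent E (γ t) 1) := by
    have := (mdifferentiable_mul_left (E := E) (γ t) 1).hasMFDerivAt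
    rw [sub_self, h.map_zero]
    exact this
  have h5 := HasMFDerivAt.comp t h4 h3
  have h6 : (fun k : G => γ t * k) ∘ γ ∘ (fun r : ℝ => r - t) = γ := by
    ext r
    simp [← h.map_add]
  rw [h6] at h5
  refine h5.congr_mfderiv ?_
  ext
  change mulLeftTangent E (γ t) 1 ((1 : ℝ) • X) = (1 : ℝ) • mulLeftTangent E (γ t) 1 X
  rw [map_smul]

/-- A one-parameter subgroup is determined by its velocity, by uniqueness of the integral curves
of left-invariant vector fields. -/
theorem IsOneParameterSubgroup.unique [CompleteSpace E] [T2Space G] [LieGroup 𝓘(ℝ, E) ∞ G]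
    {X : LieAlg E G} {γ γ' : ℝ → G} (h : IsOneParameterSubgroup X γ)
    (h' : IsOneParameterSubgroup X γ') : γ = γ' := by
  have : LieGroup 𝓘(ℝ, E) (minSmoothness ℝ 3) G :=
    LieGroup.of_le (n := ∞) (by simpa using WithTop.coe_le_coe.2 (le_top : (3 : ℕ∞) ≤ ⊤))
  have : IsManifold 𝓘(ℝ, E) 1 G := IsManifold.of_le (n := ∞) (by exact_mod_cast le_top)
  refine isMIntegralCurve_Ioo_eq_of_contMDiff_boundaryless (t₀ := 0) ?_ h.isMIntegralCurve
    h'.isMIntegralCurve (h.map_zero.trans h'.map_zero.symm)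
  refine (contMDiff_mulInvariantVectorField (I := 𝓘(ℝ, E)) (G := G) X).of_le ?_
  simp

theorem IsOneParameterSubgroup.lieExp_eq [CompleteSpace E] [T2Space G] [LieGroup 𝓘(ℝ, E) ∞ G]
    {X : LieAlg E G} {γ : ℝ → G} (h : IsOneParameterSubgroup X γ) : lieExp X = γ 1 := by
  have hex : ∃ γ : ℝ → G, IsOneParameterSubgroup X γ := ⟨γ, h⟩
  rw [lieExp, dif_pos hex, hex.choose_spec.unique h]

/-- Existence of one-parameter subgroups plays no role: if `X` had none, neither would `-X`, and both
sides would be `1`. -/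
theorem lieExp_neg [CompleteSpace E] [T2Space G] [LieGroup 𝓘(ℝ, E) ∞ G] (X : LieAlg E G) :
    (lieExp (-X) : G) = (lieExp X)⁻¹ := by
  by_cases h : ∃ γ : ℝ → G, IsOneParameterSubgroup X γ
  · obtain ⟨γ, h⟩ := h
    rw [h.lieExp_eq, h.neg.lieExp_eq, eq_inv_iff_mul_eq_one, ← h.map_add]
    simpa using h.map_zero
  · have h' : ¬ ∃ γ : ℝ → G, IsOneParameterSubgroup (-X) γ := by
      rintro ⟨γ, hγ⟩
      exact h ⟨_, by simpa using hγ.neg⟩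
    rw [lieExp, lieExp, dif_neg h, dif_neg h', inv_one]

theorem lieLog_mem {O : Set (LieAlg E G)} {g : G}
    (hg : g ∈ (lieExp : LieAlg E G → G) '' O) : lieLog O g ∈ O :=
  Function.invFunOn_mem hg

theorem lieExp_lieLog {O : Set (LieAlg E G)} {g : G}
    (hg : g ∈ (lieExp : LieAlg E G → G) '' O) : lieExp (lieLog O g) = g :=
  Function.invFunOn_eq hg

theorem IsExpDiffeoOn.contMDiffAt_lieLog {O : Set (LieAlg E G)}
    (hO : IsExpDiffeoOn O) {g : G} (hg : g ∈ (lieExp : LieAlg E G → G) '' O) :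
    ContMDiffAt 𝓘(ℝ, E) 𝓘(ℝ, E) ∞ (lieLog O : G → LieAlg E G) g :=
  hO.contMDiffOn_log.contMDiffAt (hO.isOpen_target.mem_nhds hg)

/-- The derivatives of `exp` and `exp⁻¹` at corresponding points compose to the identity. -/
theorem IsExpDiffeoOn.mfderiv_lieExp_comp_derivLog {O : Set (LieAlg E G)}
    (hO : IsExpDiffeoOn O) {g : G} (hg : g ∈ (lieExp : LieAlg E G → G) '' O) :
    (mfderiv 𝓘(ℝ, E) 𝓘(ℝ, E) (lieExp : LieAlg E G → G) (lieLog O g) : E →L[ℝ] E).comp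
      (derivLog O g : E →L[ℝ] E) = ContinuousLinearMap.id ℝ E := by
  have h1 : MDifferentiableAt 𝓘(ℝ, E) 𝓘(ℝ, E) (lieExp : LieAlg E G → G) (lieLog O g) :=
    (hO.contMDiffOn_exp.contMDiffAt (hO.isOpen_source.mem_nhds (lieLog_mem hg))).mdifferentiableAt
      (by simp)
  have h2 := mfderiv_comp g h1 ((hO.contMDiffAt_lieLog hg).mdifferentiableAt (by simp))
  have h3 : (lieExp : LieAlg E G → G) ∘ lieLog O =ᶠ[𝓝 g] id := by
    filter_upwards [hO.isOpen_target.mem_nhds hg] with k hk using lieExp_lieLog hk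
  rw [h3.mfderiv_eq, mfderiv_id] at h2
  exact h2.symm

end Group

/-- The chain rule for a function of two variables, in terms of its partial derivatives. -/
theorem hasMFDerivAt_comp_prodMk {W E₁ E₂ E₃ : Type*} [NormedAddCommGroup W] [NormedSpace ℝ W]
    [NormedAddCommGroup E₁] [NormedSpace ℝ E₁] [NormedAddCommGroup E₂] [NormedSpace ℝ E₂]
    [NormedAddCommGroup E₃] [NormedSpace ℝ E₃]
    {H₁ H₂ H₃ : Type*} [TopologicalSpace H₁] [TopologicalSpace H₂] [TopologicalSpace H₃]
    {I₁ : ModelWithCorners ℝ E₁ H₁} {I₂ : ModelWithCorners ℝ E₂ H₂}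
    {I₃ : ModelWithCorners ℝ E₃ H₃}
    {M₁ M₂ M₃ : Type*} [TopologicalSpace M₁] [ChartedSpace H₁ M₁] [TopologicalSpace M₂]
    [ChartedSpace H₂ M₂] [TopologicalSpace M₃] [ChartedSpace H₃ M₃]
    {g : M₁ × M₂ → M₃} {a : W → M₁} {b : W → M₂} {w : W} {a' : W →L[ℝ] E₁} {b' : W →L[ℝ] E₂}
    (hg : MDifferentiableAt (I₁.prod I₂) I₃ g (a w, b w))
    (ha : HasMFDerivAt 𝓘(ℝ, W) I₁ a w a') (hb : HasMFDerivAt 𝓘(ℝ, W) I₂ b w b') :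
    HasMFDerivAt 𝓘(ℝ, W) I₃ (fun v => g (a v, b v)) w
      ((mfderiv I₁ I₃ (fun z => g (z, b w)) (a w) : E₁ →L[ℝ] E₃).comp a' +
        (mfderiv I₂ I₃ (fun z => g (a w, z)) (b w) : E₂ →L[ℝ] E₃).comp b' : W →L[ℝ] E₃) := by
  have h := HasMFDerivAt.comp w hg.hasMFDerivAt (ha.prodMk hb)
  refine h.congr_mfderiv ?_
  ext v
  exact mfderiv_prod_eq_add_apply (v := ((a' v, b' v) : E₁ × E₂)) hg

/-! ### The Hamiltonian and its derivatives -/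

theorem ofBidual_eq {V : Type*} [NormedAddCommGroup V] [NormedSpace ℝ V] [FiniteDimensional ℝ V]
    {Λ : (V →L[ℝ] ℝ) →L[ℝ] ℝ} {v : V} (h : ∀ φ : V →L[ℝ] ℝ, Λ φ = φ v) : ofBidual Λ = v := by
  by_contra hne
  obtain ⟨φ, hφ⟩ := SeparatingDual.exists_separating_of_ne (R := ℝ) hne
  exact hφ ((apply_ofBidual Λ φ).trans (h φ))

section Hamiltonian

section Covectors

variable {E : Type*} [NormedAddCommGroup E] [NormedSpace ℝ E]
  {G : Type*} [TopologicalSpace G] [ChartedSpace E G] [Group G]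
  {X V : Type*} [NormedAddCommGroup X] [NormedSpace ℝ X]
  {s : ℕ → G → X → G} {f : ℕ → G → X → V → X} {c : ℕ → G → X → V → ℝ} {O : Set (LieAlg E G)}

theorem Dζ_hamiltonian [FiniteDimensional ℝ E] (ν : ℝ) (t : ℕ) (ζ : LieAlg E G →L[ℝ] ℝ)
    (ξ : X →L[ℝ] ℝ) (q : G) (x : X) (u : V) :
    Dζ (hamiltonian O s f c ν) t ζ ξ q x u = lieLog O (s t q x) := by
  refine ofBidual_eq fun φ => ?_
  have h : HasFDerivAt (fun ζ' : E →L[ℝ] ℝ => hamiltonian O s f c ν t ζ' ξ q x u)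
      (ContinuousLinearMap.apply ℝ ℝ (lieLog O (s t q x) : E)) ζ :=
    (((ContinuousLinearMap.apply ℝ ℝ (lieLog O (s t q x) : E)).hasFDerivAt).const_add _).add_const _
  rw [h.fderiv]
  rfl

theorem Dξ_hamiltonian [FiniteDimensional ℝ X] (ν : ℝ) (t : ℕ) (ζ : LieAlg E G →L[ℝ] ℝ)
    (ξ : X →L[ℝ] ℝ) (q : G) (x : X) (u : V) :
    Dξ (hamiltonian O s f c ν) t ζ ξ q x u = f t q x u := by
  refine ofBidual_eq fun φ => ?_
  have h : HasFDerivAt (fun ξ' : X →L[ℝ] ℝ => hamiltonian O s f c ν t ζ ξ' q x u)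
      (ContinuousLinearMap.apply ℝ ℝ (f t q x u)) ξ :=
    ((ContinuousLinearMap.apply ℝ ℝ (f t q x u)).hasFDerivAt).const_add _
  rw [h.fderiv]
  rfl

end Covectors

variable {E : Type*} [NormedAddCommGroup E] [NormedSpace ℝ E]
  {G : Type*} [TopologicalSpace G] [ChartedSpace E G] [Group G]
  {X V : Type*} [NormedAddCommGroup X] [NormedSpace ℝ X]
  [NormedAddCommGroup V] [NormedSpace ℝ V]

/-- The chain rule in terms of the partial derivatives `Dq`, `Dx`, `Du`. -/
theorem fderiv_eq_Dq_add_Dx_add_Du {W : Type*} [NormedAddCommGroup W] [NormedSpace ℝ W]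
    {H : ℕ → (LieAlg E G →L[ℝ] ℝ) → (X →L[ℝ] ℝ) → G → X → V → ℝ} {t : ℕ}
    {ζ : LieAlg E G →L[ℝ] ℝ} {ξ : X →L[ℝ] ℝ} {a : W → G}
    {b : W → X} {v : W → V} {w : W} {a' : W →L[ℝ] E} {b' : W →L[ℝ] X} {v' : W →L[ℝ] V}
    {D : W →L[ℝ] ℝ}
    (hH : MDifferentiableAt (𝓘(ℝ, E).prod (𝓘(ℝ, X).prod 𝓘(ℝ, V))) 𝓘(ℝ, ℝ)
      (fun p : G × X × V => H t ζ ξ p.1 p.2.1 p.2.2) (a w, b w, v w))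
    (ha : HasMFDerivAt 𝓘(ℝ, W) 𝓘(ℝ, E) a w a') (hb : HasFDerivAt b b' w)
    (hv : HasFDerivAt v v' w) (hD : HasFDerivAt (fun z => H t ζ ξ (a z) (b z) (v z)) D w) (δ : W) :
    D δ = Dq H t ζ ξ (a w) (b w) (v w) (a' δ) + Dx H t ζ ξ (a w) (b w) (v w) (b' δ) +
      Du H t ζ ξ (a w) (b w) (v w) (v' δ) := by
  have hbv : HasMFDerivAt 𝓘(ℝ, W) (𝓘(ℝ, X).prod 𝓘(ℝ, V)) (fun z => (b z, v z)) w (b'.prod v') :=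
    hb.hasMFDerivAt.prodMk hv.hasMFDerivAt
  have hin : MDifferentiableAt (𝓘(ℝ, X).prod 𝓘(ℝ, V)) 𝓘(ℝ, ℝ)
      (fun z : X × V => H t ζ ξ (a w) z.1 z.2) (b w, v w) :=
    MDifferentiableAt.comp (f := fun z : X × V => (a w, z)) (b w, v w) hH
      (mdifferentiableAt_const.prodMk mdifferentiableAt_id)
  have h1 := hasMFDerivAt_comp_prodMk (g := fun p : G × X × V => H t ζ ξ p.1 p.2.1 p.2.2)
    (b := fun z => (b z, v z)) hH ha hbv
  have h2 := hasMFDerivAt_comp_prodMk (g := fun z : X × V => H t ζ ξ (a w) z.1 z.2)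
    hin hb.hasMFDerivAt hv.hasMFDerivAt
  have h3 := hasMFDerivAt_unique (HasMFDerivAt.comp (f := fun z => (b z, v z)) w
    hin.hasMFDerivAt hbv) h2
  have h4 := DFunLike.congr_fun (hasMFDerivAt_unique hD.hasMFDerivAt h1) δ
  have h5 := DFunLike.congr_fun h3 δ
  rw [mfderiv_eq_fderiv, mfderiv_eq_fderiv] at h5
  refine h4.trans ((congrArg (fun r : ℝ => Dq H t ζ ξ (a w) (b w) (v w) (a' δ) + r) h5).trans ?_)
  exact (add_assoc (Dq H t ζ ξ (a w) (b w) (v w) (a' δ)) (Dx H t ζ ξ (a w) (b w) (v w) (b' δ)) _).symm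

variable
  {s : ℕ → G → X → G} {f : ℕ → G → X → V → X} {c : ℕ → G → X → V → ℝ} {O : Set (LieAlg E G)}

theorem mdifferentiableAt_hamiltonian {t : ℕ} {q : G} {x : X} {u : V} (hO : IsExpDiffeoOn O)
    (hs : ContMDiff (𝓘(ℝ, E).prod 𝓘(ℝ, X)) 𝓘(ℝ, E) ∞ (fun p : G × X => s t p.1 p.2))
    (hf : ContMDiff (𝓘(ℝ, E).prod (𝓘(ℝ, X).prod 𝓘(ℝ, V))) 𝓘(ℝ, X) ∞
      (fun p : G × X × V => f t p.1 p.2.1 p.2.2))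
    (hc : ContMDiff (𝓘(ℝ, E).prod (𝓘(ℝ, X).prod 𝓘(ℝ, V))) 𝓘(ℝ, ℝ) ∞
      (fun p : G × X × V => c t p.1 p.2.1 p.2.2))
    (hsO : s t q x ∈ (lieExp : LieAlg E G → G) '' O)
    (ν : ℝ) (ζ : LieAlg E G →L[ℝ] ℝ) (ξ : X →L[ℝ] ℝ) :
    MDifferentiableAt (𝓘(ℝ, E).prod (𝓘(ℝ, X).prod 𝓘(ℝ, V))) 𝓘(ℝ, ℝ)
      (fun p : G × X × V => hamiltonian O s f c ν t ζ ξ p.1 p.2.1 p.2.2) (q, x, u) := by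
  have h1 : MDifferentiableAt (𝓘(ℝ, E).prod (𝓘(ℝ, X).prod 𝓘(ℝ, V))) 𝓘(ℝ, ℝ)
      (fun p : G × X × V => ν * c t p.1 p.2.1 p.2.2) (q, x, u) :=
    ((hc.mdifferentiable (by simp)) (q, x, u)).const_smul ν
  have h2 : MDifferentiableAt (𝓘(ℝ, E).prod (𝓘(ℝ, X).prod 𝓘(ℝ, V))) 𝓘(ℝ, E)
      (fun p : G × X × V => s t p.1 p.2.1) (q, x, u) :=
    MDifferentiableAt.comp (f := fun p : G × X × V => (p.1, p.2.1)) (q, x, u)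
      ((hs.mdifferentiable (by simp)) (q, x))
      (mdifferentiableAt_fst.prodMk (mdifferentiableAt_fst.comp _ mdifferentiableAt_snd))
  have h3 : MDifferentiableAt (𝓘(ℝ, E).prod (𝓘(ℝ, X).prod 𝓘(ℝ, V))) 𝓘(ℝ, E)
      (fun p : G × X × V => (lieLog O (s t p.1 p.2.1) : E)) (q, x, u) :=
    MDifferentiableAt.comp (f := fun p : G × X × V => s t p.1 p.2.1) (q, x, u)
      ((hO.contMDiffAt_lieLog hsO).mdifferentiableAt (by simp)) h2
  have h4 : MDifferentiableAt (𝓘(ℝ, E).prod (𝓘(ℝ, X).prod 𝓘(ℝ, V))) 𝓘(ℝ, ℝ)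
      (fun p : G × X × V => (ζ : E →L[ℝ] ℝ) (lieLog O (s t p.1 p.2.1) : E)) (q, x, u) :=
    MDifferentiableAt.comp (f := fun p : G × X × V => (lieLog O (s t p.1 p.2.1) : E)) (q, x, u)
      (ζ : E →L[ℝ] ℝ).differentiableAt.mdifferentiableAt h3
  have h5 : MDifferentiableAt (𝓘(ℝ, E).prod (𝓘(ℝ, X).prod 𝓘(ℝ, V))) 𝓘(ℝ, ℝ)
      (fun p : G × X × V => ξ (f t p.1 p.2.1 p.2.2)) (q, x, u) :=
    MDifferentiableAt.comp (f := fun p : G × X × V => f t p.1 p.2.1 p.2.2) (q, x, u)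
      ξ.differentiableAt.mdifferentiableAt ((hf.mdifferentiable (by simp)) (q, x, u))
  exact (h1.add h4).add h5

/-- The covector `ζ ∈ 𝔤*` with `ζ ∘ 𝒟exp⁻¹(g) = p ∘ T_gΦ_q`, for a covector `p` at `q g`. -/
noncomputable def pullbackCovector (O : Set (LieAlg E G)) (q g : G) (p : E →L[ℝ] ℝ) :
    LieAlg E G →L[ℝ] ℝ :=
  (p.comp (mulLeftTangent E q g)).comp
    (mfderiv 𝓘(ℝ, E) 𝓘(ℝ, E) (lieExp : LieAlg E G → G) (lieLog O g) : E →L[ℝ] E)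

theorem pullbackCovector_comp_derivLog (hO : IsExpDiffeoOn O) {g : G}
    (hg : g ∈ (lieExp : LieAlg E G → G) '' O) (q : G) (p : E →L[ℝ] ℝ) :
    (pullbackCovector O q g p : E →L[ℝ] ℝ).comp (derivLog O g : E →L[ℝ] E) =
      p.comp (mulLeftTangent E q g) := by
  exact congrArg (fun A : E →L[ℝ] E => (p.comp (mulLeftTangent E q g)).comp A)
    (hO.mfderiv_lieExp_comp_derivLog hg)

theorem eq_zero_of_pullbackCovector_eq_zero [LieGroup 𝓘(ℝ, E) ∞ G] (hO : IsExpDiffeoOn O) {q g : G}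
    (hg : g ∈ (lieExp : LieAlg E G → G) '' O) {p : E →L[ℝ] ℝ}
    (h : pullbackCovector O q g p = 0) : p = 0 := by
  have h1 := pullbackCovector_comp_derivLog hO hg q p
  rw [h, ContinuousLinearMap.zero_comp] at h1
  exact eq_zero_of_comp_mulLeftTangent h1.symm

/-- In the left trivialization `pullbackCovector O q g p` represents `p` at the point `q g`. -/
theorem coDerivLog_pullbackCovector [LieGroup 𝓘(ℝ, E) ∞ G] (hO : IsExpDiffeoOn O) {g : G}
    (hg : g ∈ (lieExp : LieAlg E G → G) '' O) (q : G) (p : E →L[ℝ] ℝ) :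
    coDerivLog O g (pullbackCovector O q g p) =
      p.comp (leftTangent (E := E) (q * g) : E →L[ℝ] E) := by
  have h1 := congrArg (fun A : E →L[ℝ] ℝ => A.comp (leftTangent (E := E) g : E →L[ℝ] E))
    (pullbackCovector_comp_derivLog hO hg q p)
  exact h1.trans (congrArg (fun A : E →L[ℝ] E => p.comp A) (leftTangent_mul q g).symm)

/-- One step of the duality between the linearized dynamics and the adjoint recursion: pairing
`(ν, p, ξ)` with the derivatives of the running cost and of the next state along a smooth family
`(a, b, v)` of states and controls gives the derivatives of the Hamiltonian, up to the term that
comes from the right translation by `s_t`. -/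
theorem adjoint_step [LieGroup 𝓘(ℝ, E) ∞ G] {W : Type*} [NormedAddCommGroup W] [NormedSpace ℝ W]
    {t : ℕ} {q : G} {x : X} {u : V} {a : W → G} {b : W → X} {v : W → V} {w : W}
    {a' a₁' : W →L[ℝ] E} {b' b₁' : W →L[ℝ] X} {v' : W →L[ℝ] V} {c' : W →L[ℝ] ℝ}
    (hO : IsExpDiffeoOn O)
    (hs : ContMDiff (𝓘(ℝ, E).prod 𝓘(ℝ, X)) 𝓘(ℝ, E) ∞ (fun p : G × X => s t p.1 p.2))
    (hf : ContMDiff (𝓘(ℝ, E).prod (𝓘(ℝ, X).prod 𝓘(ℝ, V))) 𝓘(ℝ, X) ∞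
      (fun p : G × X × V => f t p.1 p.2.1 p.2.2))
    (hc : ContMDiff (𝓘(ℝ, E).prod (𝓘(ℝ, X).prod 𝓘(ℝ, V))) 𝓘(ℝ, ℝ) ∞
      (fun p : G × X × V => c t p.1 p.2.1 p.2.2))
    (hq : a w = q) (hx : b w = x) (hu : v w = u)
    (hsO : s t q x ∈ (lieExp : LieAlg E G → G) '' O)
    (ha : HasMFDerivAt 𝓘(ℝ, W) 𝓘(ℝ, E) a w a') (hb : HasFDerivAt b b' w)
    (hv : HasFDerivAt v v' w)
    (ha₁ : HasMFDerivAt 𝓘(ℝ, W) 𝓘(ℝ, E) (fun z => a z * s t (a z) (b z)) w a₁')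
    (hb₁ : HasFDerivAt (fun z => f t (a z) (b z) (v z)) b₁' w)
    (hc₁ : HasFDerivAt (fun z => c t (a z) (b z) (v z)) c' w)
    (ν : ℝ) (p : E →L[ℝ] ℝ) (ξ : X →L[ℝ] ℝ) (δ : W) :
    let ζ := pullbackCovector O q (s t q x) p
    let H := hamiltonian O s f c ν
    ν * c' δ + p (a₁' δ) + ξ (b₁' δ) =
      p (mulRightTangent E (s t q x) q (a' δ)) + Dq H t ζ ξ q x u (a' δ) +
        Dx H t ζ ξ q x u (b' δ) + Du H t ζ ξ q x u (v' δ) := by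
  subst hq hx hu
  intro ζ H
  set g := s t (a w) (b w) with hg
  obtain ⟨σ', hσ⟩ : ∃ σ' : W →L[ℝ] E,
      HasMFDerivAt 𝓘(ℝ, W) 𝓘(ℝ, E) (fun z => s t (a z) (b z)) w σ' :=
    ⟨_, hasMFDerivAt_comp_prodMk (g := fun p : G × X => s t p.1 p.2)
      ((hs.mdifferentiable (by simp)) (a w, b w)) ha hb.hasMFDerivAt⟩
  have hmul : MDifferentiableAt (𝓘(ℝ, E).prod 𝓘(ℝ, E)) 𝓘(ℝ, E) (fun p : G × G => p.1 * p.2)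
      (a w, g) := (contMDiff_mul 𝓘(ℝ, E) ∞).mdifferentiableAt (by simp)
  have h1 : a₁' = (mulRightTangent E g (a w)).comp a' + (mulLeftTangent E (a w) g).comp σ' :=
    hasMFDerivAt_unique ha₁ (hasMFDerivAt_comp_prodMk hmul ha hσ)
  have h3 : HasMFDerivAt 𝓘(ℝ, W) 𝓘(ℝ, E) (fun z => (lieLog O (s t (a z) (b z)) : E)) w
      ((derivLog O g : E →L[ℝ] E).comp σ') :=
    HasMFDerivAt.comp (f := fun z => s t (a z) (b z)) w
      ((hO.contMDiffAt_lieLog hsO).mdifferentiableAt (by simp)).hasMFDerivAt hσ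
  have h4 : HasFDerivAt (fun z => H t ζ ξ (a z) (b z) (v z))
      (ν • c' + (ζ : E →L[ℝ] ℝ).comp ((derivLog O g : E →L[ℝ] E).comp σ') + ξ.comp b₁') w :=
    ((hc₁.const_smul ν).add
      ((ζ : E →L[ℝ] ℝ).hasFDerivAt.comp w h3.hasFDerivAt)).add (ξ.hasFDerivAt.comp w hb₁)
  have h5 := fderiv_eq_Dq_add_Dx_add_Du (H := H)
    (mdifferentiableAt_hamiltonian hO hs hf hc hsO ν ζ ξ) ha hb hv h4 δ
  have h6 : (ζ : E →L[ℝ] ℝ) ((derivLog O g : E →L[ℝ] E) (σ' δ)) =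
      p (mulLeftTangent E (a w) g (σ' δ)) :=
    DFunLike.congr_fun (pullbackCovector_comp_derivLog hO hsO (a w) p) (σ' δ)
  have h7 : (ν • c' + (ζ : E →L[ℝ] ℝ).comp ((derivLog O g : E →L[ℝ] E).comp σ') + ξ.comp b₁') δ =
      ν * c' δ + p (mulLeftTangent E (a w) g (σ' δ)) + ξ (b₁' δ) := by
    rw [← h6]
    rfl
  rw [h7] at h5
  have h8 : p (a₁' δ) = p (mulRightTangent E g (a w) (a' δ)) +
      p (mulLeftTangent E (a w) g (σ' δ)) := by
    rw [h1, ← map_add]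
    rfl
  rw [h8]
  linarith

end Hamiltonian

/-! ### Trajectories as functions of the control sequence -/

section Trajectory

variable {G : Type*} [Group G] {X V : Type*}

/-- The state sequence `(q_t, x_t)` generated by a control sequence from the initial state
`(q₀, x₀)`. -/
def trajectory (s : ℕ → G → X → G) (f : ℕ → G → X → V → X) (q₀ : G) (x₀ : X) (u : ℕ → V) :
    ℕ → G × X
  | 0 => (q₀, x₀)
  | t + 1 => ((trajectory s f q₀ x₀ u t).1 *
      s t (trajectory s f q₀ x₀ u t).1 (trajectory s f q₀ x₀ u t).2,
      f t (trajectory s f q₀ x₀ u t).1 (trajectory s f q₀ x₀ u t).2 (u t))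

/-- A state sequence that follows the dynamics up to time `N` is the trajectory of any control
sequence that agrees with its own before time `N`. -/
theorem trajectory_eq {s : ℕ → G → X → G} {f : ℕ → G → X → V → X} {N : ℕ}
    {q : ℕ → G} {x : ℕ → X} {u v : ℕ → V} (hq : ∀ t < N, q (t + 1) = q t * s t (q t) (x t))
    (hx : ∀ t < N, x (t + 1) = f t (q t) (x t) (u t)) (huv : ∀ t < N, v t = u t) :
    ∀ t ≤ N, trajectory s f (q 0) (x 0) v t = (q t, x t) := by
  intro t
  induction t with
  | zero => intro _; rfl
  | succ t ih =>
    intro ht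
    rw [trajectory, ih (by omega), hq t ht, hx t ht, huv t ht]

end Trajectory

/-- The control at time `t` of a finite control sequence, as a continuous linear map; it is `0`
for `t ≥ N`. -/
noncomputable def controlAt (V : Type*) [NormedAddCommGroup V] [NormedSpace ℝ V] (N t : ℕ) :
    (Fin N → V) →L[ℝ] V :=
  if h : t < N then ContinuousLinearMap.proj (φ := fun _ : Fin N => V) ⟨t, h⟩ else 0

theorem controlAt_apply {V : Type*} [NormedAddCommGroup V] [NormedSpace ℝ V] {N t : ℕ} (h : t < N)
    (w : Fin N → V) : controlAt V N t w = w ⟨t, h⟩ := by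
  simp [controlAt, h]

theorem contMDiff_trajectory {E : Type*} [NormedAddCommGroup E] [NormedSpace ℝ E]
    {G : Type*} [TopologicalSpace G] [ChartedSpace E G] [Group G] [LieGroup 𝓘(ℝ, E) ∞ G]
    {X V : Type*} [NormedAddCommGroup X] [NormedSpace ℝ X]
    [NormedAddCommGroup V] [NormedSpace ℝ V] {N : ℕ}
    {s : ℕ → G → X → G} {f : ℕ → G → X → V → X}
    (hs : ∀ t < N, ContMDiff (𝓘(ℝ, E).prod 𝓘(ℝ, X)) 𝓘(ℝ, E) ∞ (fun p : G × X => s t p.1 p.2))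
    (hf : ∀ t < N, ContMDiff (𝓘(ℝ, E).prod (𝓘(ℝ, X).prod 𝓘(ℝ, V))) 𝓘(ℝ, X) ∞
      (fun p : G × X × V => f t p.1 p.2.1 p.2.2)) (q₀ : G) (x₀ : X) :
    ∀ t ≤ N, ContMDiff 𝓘(ℝ, Fin N → V) (𝓘(ℝ, E).prod 𝓘(ℝ, X)) ∞
      (fun w : Fin N → V => trajectory s f q₀ x₀ (fun τ => controlAt V N τ w) t) := by
  intro t
  induction t with
  | zero => intro _; exact contMDiff_const
  | succ t ih =>
    intro ht
    have h := ih (by omega)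
    have h1 := contMDiff_fst.comp h
    have h2 := contMDiff_snd.comp h
    have hv : ContMDiff 𝓘(ℝ, Fin N → V) 𝓘(ℝ, V) ∞ (fun w : Fin N → V => controlAt V N t w) :=
      (controlAt V N t).contMDiff
    exact (h1.mul ((hs t ht).comp (h1.prodMk h2))).prodMk ((hf t ht).comp (h1.prodMk (h2.prodMk hv)))

/-- The coordinate expression of `g` in the chart centred at `g w` has the manifold derivative of
`g` at `w` as its derivative. -/
theorem hasStrictFDerivAt_extChartAt_comp {W E G : Type*} [NormedAddCommGroup W] [NormedSpace ℝ W]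
    [NormedAddCommGroup E] [NormedSpace ℝ E] [TopologicalSpace G] [ChartedSpace E G]
    [IsManifold 𝓘(ℝ, E) ∞ G] {g : W → G} {w : W} {g' : W →L[ℝ] E}
    (hg : ContMDiffAt 𝓘(ℝ, W) 𝓘(ℝ, E) ∞ g w) (hg' : HasMFDerivAt 𝓘(ℝ, W) 𝓘(ℝ, E) g w g') :
    HasStrictFDerivAt (fun z => extChartAt 𝓘(ℝ, E) (g w) (g z)) g' w := by
  have h1 : ContMDiffAt 𝓘(ℝ, W) 𝓘(ℝ, E) ∞ (fun z => extChartAt 𝓘(ℝ, E) (g w) (g z)) w :=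
    contMDiffAt_extChartAt.comp w hg
  have h2 := h1.contDiffAt.hasStrictFDerivAt (by simp)
  have h3 : HasFDerivAt (fun z => extChartAt 𝓘(ℝ, E) (g w) (g z)) g' w := by
    have := hg'.2
    simp only [writtenInExtChartAt, mfld_simps] at this
    exact hasFDerivWithinAt_univ.1 this
  rwa [h2.hasFDerivAt.unique h3] at h2

/-- Existence of a sequence with prescribed final value that solves a backward recursion. -/
theorem exists_backward_recursion {α : Type*} (N : ℕ) (a : α) (g : ℕ → α → α) :
    ∃ P : ℕ → α, P N = a ∧ ∀ t < N, P t = g t (P (t + 1)) := by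
  induction N generalizing a with
  | zero => exact ⟨fun _ => a, rfl, by simp⟩
  | succ N ih =>
    obtain ⟨P, hP, hrec⟩ := ih (g N a)
    refine ⟨fun t => if t ≤ N then P t else a, by simp, fun t ht => ?_⟩
    rcases Nat.lt_succ_iff_lt_or_eq.1 ht with h | rfl
    · simp [h.le, Nat.succ_le_of_lt h, hrec t h]
    · simp [hP]

/-! ### Multipliers for the reduced problem and the adjoint recursion -/

theorem IsAdmissible.trajectory_eq {G X V : Type*} [Group G] [NormedAddCommGroup V]
    [NormedSpace ℝ V] {N : ℕ} {s : ℕ → G → X → G} {f : ℕ → G → X → V → X}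
    {U : ℕ → Set V} {q₀ : G} {x₀ : X} {q_N : G} {x_N : X} {q : ℕ → G} {x : ℕ → X} {u : ℕ → V}
    (h : IsAdmissible N s f U q₀ x₀ q_N x_N q x u) :
    ∀ t ≤ N, trajectory s f q₀ x₀ (fun τ => controlAt V N τ fun i => u i) t = (q t, x t) := by
  have := LieOCP.trajectory_eq (v := fun τ => controlAt V N τ fun i => u i) h.dyn_q h.dyn_x
    (fun t ht => controlAt_apply ht _)
  rwa [h.init_q, h.init_x] at this

section Reduced

variable {E : Type*} [NormedAddCommGroup E] [NormedSpace ℝ E]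
  {G : Type*} [TopologicalSpace G] [ChartedSpace E G] [Group G] [LieGroup 𝓘(ℝ, E) ∞ G]
  {X V : Type*} [NormedAddCommGroup X] [NormedSpace ℝ X]
  [NormedAddCommGroup V] [NormedSpace ℝ V] {N : ℕ}
  {s : ℕ → G → X → G} {f : ℕ → G → X → V → X} {c : ℕ → G → X → V → ℝ}
  {U : ℕ → Set V} {q₀ : G} {x₀ : X} {q_N : G} {x_N : X}
  {q : ℕ → G} {x : ℕ → X} {u : ℕ → V}

/-- The Fritz John rule applied to the problem in which the states are functions of the controls:
`p` and `π` are the multipliers of the endpoint constraints on `q_N` and `x_N`. -/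
theorem IsOptimal.exists_terminal_multiplier [FiniteDimensional ℝ E] [FiniteDimensional ℝ X]
    (hs : ∀ t < N, ContMDiff (𝓘(ℝ, E).prod 𝓘(ℝ, X)) 𝓘(ℝ, E) ∞ (fun p : G × X => s t p.1 p.2))
    (hf : ∀ t < N, ContMDiff (𝓘(ℝ, E).prod (𝓘(ℝ, X).prod 𝓘(ℝ, V))) 𝓘(ℝ, X) ∞
      (fun p : G × X × V => f t p.1 p.2.1 p.2.2))
    (hc : ∀ t < N, ContMDiff (𝓘(ℝ, E).prod (𝓘(ℝ, X).prod 𝓘(ℝ, V))) 𝓘(ℝ, ℝ) ∞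
      (fun p : G × X × V => c t p.1 p.2.1 p.2.2))
    (hU : ∀ t < N, Convex ℝ (U t)) (hopt : IsOptimal N s f c U q₀ x₀ q_N x_N q x u)
    {Q' : (Fin N → V) →L[ℝ] E} {X' : (Fin N → V) →L[ℝ] X} {J' : (Fin N → V) →L[ℝ] ℝ}
    (hQ : HasMFDerivAt 𝓘(ℝ, Fin N → V) 𝓘(ℝ, E)
      (fun w => (trajectory s f q₀ x₀ (fun τ => controlAt V N τ w) N).1) (fun i : Fin N => u i) Q')
    (hX : HasFDerivAt (fun w => (trajectory s f q₀ x₀ (fun τ => controlAt V N τ w) N).2) X'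
      (fun i => u i))
    (hJ : HasFDerivAt (fun w => cost N c
      (fun t => (trajectory s f q₀ x₀ (fun τ => controlAt V N τ w) t).1)
      (fun t => (trajectory s f q₀ x₀ (fun τ => controlAt V N τ w) t).2)
      (fun t => controlAt V N t w)) J' (fun i => u i)) :
    ∃ (ν : ℝ) (p : E →L[ℝ] ℝ) (π : X →L[ℝ] ℝ), (ν = -1 ∨ ν = 0) ∧ ¬ (ν = 0 ∧ p = 0 ∧ π = 0) ∧
      ∀ w : Fin N → V, (∀ i : Fin N, w i ∈ U i) →
        ν * J' (w - fun i : Fin N => u i) + p (Q' (w - fun i : Fin N => u i)) +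
          π (X' (w - fun i : Fin N => u i)) ≤ 0 := by
  have hadm := hopt.admissible
  set w₀ : Fin N → V := fun i => u i with hw₀
  set T : ℕ → (Fin N → V) → G × X :=
    fun t w => trajectory s f q₀ x₀ (fun τ => controlAt V N τ w) t with hT
  have hTw₀ : ∀ t ≤ N, T t w₀ = (q t, x t) := hadm.trajectory_eq
  have hTN : T N w₀ = (q_N, x_N) := by rw [hTw₀ N le_rfl, hadm.final_q, hadm.final_x]
  have hsm : ∀ t ≤ N, ContMDiff 𝓘(ℝ, Fin N → V) (𝓘(ℝ, E).prod 𝓘(ℝ, X)) ∞ (T t) :=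
    contMDiff_trajectory hs hf q₀ x₀
  have hJsm : ContMDiff 𝓘(ℝ, Fin N → V) 𝓘(ℝ, ℝ) ∞ (fun w => cost N c
      (fun t => (T t w).1) (fun t => (T t w).2) (fun t => controlAt V N t w)) := by
    refine contMDiff_finsetSum fun t ht => ?_
    have ht := Finset.mem_range.1 ht
    exact (hc t ht).comp ((contMDiff_fst.comp (hsm t ht.le)).prodMk
      ((contMDiff_snd.comp (hsm t ht.le)).prodMk (controlAt V N t).contMDiff))
  have hJ' : HasStrictFDerivAt (fun w => cost N c
      (fun t => (T t w).1) (fun t => (T t w).2) (fun t => controlAt V N t w)) J' w₀ := by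
    have h := hJsm.contDiff.contDiffAt.hasStrictFDerivAt (x := w₀) (by simp)
    rwa [h.hasFDerivAt.unique hJ] at h
  have hX' : HasStrictFDerivAt (fun w => (T N w).2) X' w₀ := by
    have h := (contMDiff_snd.comp (hsm N le_rfl)).contDiff.contDiffAt.hasStrictFDerivAt
      (x := w₀) (by simp)
    rwa [h.hasFDerivAt.unique hX] at h
  have : IsManifold 𝓘(ℝ, E) ∞ G := inferInstance
  have hQsm : ContMDiff 𝓘(ℝ, Fin N → V) 𝓘(ℝ, E) ∞ (fun w => (T N w).1) :=
    contMDiff_fst.comp (hsm N le_rfl)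
  have hQ' := hasStrictFDerivAt_extChartAt_comp hQsm.contMDiffAt hQ
  let C : Set (Fin N → V) := {w | ∀ i : Fin N, w i ∈ U i}
  have hC : Convex ℝ C := by
    intro a ha b hb r r' hr hr' hrr i
    exact hU i i.2 (ha i) (hb i) hr hr' hrr
  have hw₀C : w₀ ∈ C := fun i => hadm.control i i.2
  have hmin : ∀ᶠ w in 𝓝 w₀, w ∈ C →
      (extChartAt 𝓘(ℝ, E) (T N w₀).1 (T N w).1, (T N w).2) =
        (extChartAt 𝓘(ℝ, E) (T N w₀).1 (T N w₀).1, (T N w₀).2) →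
      cost N c (fun t => (T t w₀).1) (fun t => (T t w₀).2) (fun t => controlAt V N t w₀) ≤
      cost N c (fun t => (T t w).1) (fun t => (T t w).2) (fun t => controlAt V N t w) := by
    filter_upwards [hQsm.continuous.continuousAt.eventually
      (extChartAt_source_mem_nhds (I := 𝓘(ℝ, E)) (T N w₀).1)] with w hw hwC hFw
    have h1 : (T N w).1 = (T N w₀).1 :=
      (extChartAt 𝓘(ℝ, E) (T N w₀).1).injOn hw (mem_extChartAt_source _) ((Prod.ext_iff.1 hFw).1)
    have h2 : (T N w).2 = (T N w₀).2 := (Prod.ext_iff.1 hFw).2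
    have h3 : cost N c (fun t => (T t w₀).1) (fun t => (T t w₀).2) (fun t => controlAt V N t w₀)
        = cost N c q x u := by
      refine Finset.sum_congr rfl fun t ht => ?_
      have ht := Finset.mem_range.1 ht
      have h4 : controlAt V N t w₀ = u t := controlAt_apply ht _
      simp only [hTw₀ t ht.le, h4]
    rw [h3]
    refine hopt.cost_le _ _ _ ⟨fun t _ => rfl, fun t _ => rfl, fun t ht => ?_, rfl, rfl, ?_, ?_⟩
    · rw [controlAt_apply ht]
      exact hwC ⟨t, ht⟩
    · rw [h1, hTN]
    · rw [h2, hTN]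
  obtain ⟨ν, l, hν, hne, hle⟩ := exists_multiplier_of_local_min hC hw₀C hJ' (hQ'.prodMk hX') hmin
  have hl : ∀ a b, l (a, b) = l.comp (.inl ℝ E X) a + l.comp (.inr ℝ E X) b := by
    intro a b
    rw [ContinuousLinearMap.comp_apply, ContinuousLinearMap.comp_apply, ← map_add]
    simp
  refine ⟨ν, l.comp (.inl ℝ E X), l.comp (.inr ℝ E X), hν, fun h => hne ⟨h.1, ?_⟩, fun w hw => ?_⟩
  · ext a
    · simpa using DFunLike.congr_fun h.2.1 a
    · simpa using DFunLike.congr_fun h.2.2 a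
  · have := hle w hw
    rw [ContinuousLinearMap.prod_apply, hl] at this
    linarith

/-- Along the adjoint recursion the multipliers of the endpoint constraints turn the first
variation of the reduced problem into the sum of the control derivatives of the Hamiltonian. -/
theorem IsAdmissible.sum_Du_hamiltonian {O : Set (LieAlg E G)} (hO : IsExpDiffeoOn O)
    (hs : ∀ t < N, ContMDiff (𝓘(ℝ, E).prod 𝓘(ℝ, X)) 𝓘(ℝ, E) ∞ (fun p : G × X => s t p.1 p.2))
    (hf : ∀ t < N, ContMDiff (𝓘(ℝ, E).prod (𝓘(ℝ, X).prod 𝓘(ℝ, V))) 𝓘(ℝ, X) ∞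
      (fun p : G × X × V => f t p.1 p.2.1 p.2.2))
    (hc : ∀ t < N, ContMDiff (𝓘(ℝ, E).prod (𝓘(ℝ, X).prod 𝓘(ℝ, V))) 𝓘(ℝ, ℝ) ∞
      (fun p : G × X × V => c t p.1 p.2.1 p.2.2))
    (hadm : IsAdmissible N s f U q₀ x₀ q_N x_N q x u)
    (hsO : ∀ t < N, s t (q t) (x t) ∈ (lieExp : LieAlg E G → G) '' O)
    {Q' : ℕ → (Fin N → V) →L[ℝ] E} {X' : ℕ → (Fin N → V) →L[ℝ] X} {J' : ℕ → (Fin N → V) →L[ℝ] ℝ}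
    (hQ : ∀ t ≤ N, HasMFDerivAt 𝓘(ℝ, Fin N → V) 𝓘(ℝ, E)
      (fun w => (trajectory s f q₀ x₀ (fun τ => controlAt V N τ w) t).1) (fun i => u i) (Q' t))
    (hX : ∀ t ≤ N, HasFDerivAt
      (fun w => (trajectory s f q₀ x₀ (fun τ => controlAt V N τ w) t).2) (X' t) (fun i => u i))
    (hJ : ∀ t < N, HasFDerivAt (fun w => c t
      (trajectory s f q₀ x₀ (fun τ => controlAt V N τ w) t).1
      (trajectory s f q₀ x₀ (fun τ => controlAt V N τ w) t).2
      (controlAt V N t w)) (J' t) (fun i => u i))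
    (ν : ℝ) {P : ℕ → (E →L[ℝ] ℝ) × (X →L[ℝ] ℝ)} {ζ : ℕ → (LieAlg E G →L[ℝ] ℝ)}
    (hζ : ∀ t, ζ t = pullbackCovector O (q t) (s t (q t) (x t)) (P (t + 1)).1)
    (hp : ∀ t < N, ∀ y : E, (P t).1 y =
      (P (t + 1)).1 (mulRightTangent E (s t (q t) (x t)) (q t) y) +
        Dq (hamiltonian O s f c ν) t (ζ t) (P (t + 1)).2 (q t) (x t) (u t) y)
    (hπ : ∀ t < N, (P t).2 =
      Dx (hamiltonian O s f c ν) t (ζ t) (P (t + 1)).2 (q t) (x t) (u t))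
    (δ : Fin N → V) :
    ∀ t ≤ N, ν * (∑ τ ∈ Finset.range t, J' τ δ) + (P t).1 (Q' t δ) + (P t).2 (X' t δ) =
      ∑ τ ∈ Finset.range t, Du (hamiltonian O s f c ν) τ (ζ τ) (P (τ + 1)).2
        (q τ) (x τ) (u τ) (controlAt V N τ δ) := by
  intro t
  induction t with
  | zero =>
    intro _
    have h1 : Q' 0 = 0 := hasMFDerivAt_unique (hQ 0 (Nat.zero_le _)) (hasMFDerivAt_const q₀ _)
    have h2 : X' 0 = 0 := (hX 0 (Nat.zero_le _)).unique (hasFDerivAt_const x₀ _)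
    simp [h1, h2]
  | succ t ih =>
    intro ht
    have hT := hadm.trajectory_eq t (Nat.le_of_succ_le ht)
    have key := adjoint_step (v := fun w => controlAt V N t w) hO (hs t ht) (hf t ht) (hc t ht)
      (congrArg Prod.fst hT) (congrArg Prod.snd hT) (controlAt_apply ht _) (hsO t ht)
      (hQ t (Nat.le_of_succ_le ht)) (hX t (Nat.le_of_succ_le ht)) (controlAt V N t).hasFDerivAt
      (hQ (t + 1) ht) (hX (t + 1) ht) (hJ t ht) ν (P (t + 1)).1 (P (t + 1)).2 δ
    simp only [← hζ] at key
    have ih := ih (Nat.le_of_succ_le ht)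
    rw [hp t ht, hπ t ht] at ih
    rw [Finset.sum_range_succ, Finset.sum_range_succ, ← ih]
    linarith

end Reduced

end LieOCP

/-! ### The discrete-time maximum principle -/

theorem corollary2
    {E : Type*} [NormedAddCommGroup E] [NormedSpace ℝ E] [FiniteDimensional ℝ E]
    {G : Type*} [TopologicalSpace G] [T2Space G] [ChartedSpace E G] [Group G]
    [LieGroup 𝓘(ℝ, E) ∞ G]
    (N n m : ℕ)
    (s : ℕ → G → EuclideanSpace ℝ (Fin n) → G)
    (f : ℕ → G → EuclideanSpace ℝ (Fin n) → EuclideanSpace ℝ (Fin m) →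
      EuclideanSpace ℝ (Fin n))
    (c : ℕ → G → EuclideanSpace ℝ (Fin n) → EuclideanSpace ℝ (Fin m) → ℝ)
    (U : ℕ → Set (EuclideanSpace ℝ (Fin m)))
    (q₀ : G) (x₀ : EuclideanSpace ℝ (Fin n)) (q_N : G) (x_N : EuclideanSpace ℝ (Fin n))
    (O : Set (LieAlg E G))
    -- smoothness of the data
    (hs : ∀ t < N, ContMDiff (𝓘(ℝ, E).prod 𝓘(ℝ, EuclideanSpace ℝ (Fin n))) 𝓘(ℝ, E) ∞
      (fun p : G × EuclideanSpace ℝ (Fin n) => s t p.1 p.2))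
    (hf : ∀ t < N, ContMDiff
      (𝓘(ℝ, E).prod (𝓘(ℝ, EuclideanSpace ℝ (Fin n)).prod 𝓘(ℝ, EuclideanSpace ℝ (Fin m))))
      𝓘(ℝ, EuclideanSpace ℝ (Fin n)) ∞
      (fun p : G × EuclideanSpace ℝ (Fin n) × EuclideanSpace ℝ (Fin m) =>
        f t p.1 p.2.1 p.2.2))
    (hc : ∀ t < N, ContMDiff
      (𝓘(ℝ, E).prod (𝓘(ℝ, EuclideanSpace ℝ (Fin n)).prod 𝓘(ℝ, EuclideanSpace ℝ (Fin m))))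
      𝓘(ℝ, ℝ) ∞
      (fun p : G × EuclideanSpace ℝ (Fin n) × EuclideanSpace ℝ (Fin m) =>
        c t p.1 p.2.1 p.2.2))
    -- the exponential map is a diffeomorphism on `O`, and the integration steps along
    -- admissible trajectories lie in `exp(O)`
    (hO : IsExpDiffeoOn O)
    (hsO : ∀ (q : ℕ → G) (x : ℕ → EuclideanSpace ℝ (Fin n))
      (u : ℕ → EuclideanSpace ℝ (Fin m)),
      IsAdmissible N s f U q₀ x₀ q_N x_N q x u →
        ∀ t < N, s t (q t) (x t) ∈ (lieExp : LieAlg E G → G) '' O)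
    (hU : ∀ t < N, Convex ℝ (U t))
    -- an optimal state-action trajectory
    (q : ℕ → G) (x : ℕ → EuclideanSpace ℝ (Fin n)) (u : ℕ → EuclideanSpace ℝ (Fin m))
    (hopt : IsOptimal N s f c U q₀ x₀ q_N x_N q x u) :
    ∃ (ζ : ℕ → (LieAlg E G →L[ℝ] ℝ)) (ξ : ℕ → (EuclideanSpace ℝ (Fin n) →L[ℝ] ℝ)) (ν : ℝ),
      (ν = -1 ∨ ν = 0) ∧
      (let H := hamiltonian O s f c ν
       let step : ℕ → LieAlg E G := fun t => Dζ H t (ζ t) (ξ t) (q t) (x t) (u t)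
       let ρ : ℕ → (LieAlg E G →L[ℝ] ℝ) := fun t => coDerivLog O (lieExp (step t) : G) (ζ t)
       -- state dynamics
       (∀ t < N, q (t + 1) = q t * lieExp (step t) ∧
          x (t + 1) = Dξ H t (ζ t) (ξ t) (q t) (x t) (u t)) ∧
       -- adjoint dynamics
       (∀ t, 1 ≤ t → t < N →
          ρ (t - 1) = AdDual (lieExp (-step t) : G) (ρ t) +
            leftTrivialization (q t) (Dq H t (ζ t) (ξ t) (q t) (x t) (u t)) ∧
          ξ (t - 1) = Dx H t (ζ t) (ξ t) (q t) (x t) (u t)) ∧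
       -- Hamiltonian non-positive gradient condition
       (∀ t < N, ∀ w ∈ U t, Du H t (ζ t) (ξ t) (q t) (x t) (u t) (w - u t) ≤ 0)) ∧
      -- non-triviality
      ¬ (ν = 0 ∧ ∀ t < N, ζ t = 0 ∧ ξ t = 0) := by
  have hadm := hopt.admissible
  have hsO' : ∀ t < N, s t (q t) (x t) ∈ (lieExp : LieAlg E G → G) '' O := hsO q x u hadm
  have : CompleteSpace E := FiniteDimensional.complete ℝ E
  have hsm := contMDiff_trajectory hs hf q₀ x₀
  have hQsm : ∀ t ≤ N, ContMDiff 𝓘(ℝ, Fin N → EuclideanSpace ℝ (Fin m)) 𝓘(ℝ, E) ∞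
      (fun w => (trajectory s f q₀ x₀ (fun τ => controlAt _ N τ w) t).1) :=
    fun t ht => contMDiff_fst.comp (hsm t ht)
  have hXsm : ∀ t ≤ N, ContMDiff 𝓘(ℝ, Fin N → EuclideanSpace ℝ (Fin m))
      𝓘(ℝ, EuclideanSpace ℝ (Fin n)) ∞
      (fun w => (trajectory s f q₀ x₀ (fun τ => controlAt _ N τ w) t).2) :=
    fun t ht => contMDiff_snd.comp (hsm t ht)
  have hcsm : ∀ t < N, ContMDiff 𝓘(ℝ, Fin N → EuclideanSpace ℝ (Fin m)) 𝓘(ℝ, ℝ) ∞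
      (fun w => c t (trajectory s f q₀ x₀ (fun τ => controlAt _ N τ w) t).1
        (trajectory s f q₀ x₀ (fun τ => controlAt _ N τ w) t).2 (controlAt _ N t w)) :=
    fun t ht => (hc t ht).comp ((hQsm t ht.le).prodMk
      ((hXsm t ht.le).prodMk (controlAt (EuclideanSpace ℝ (Fin m)) N t).contMDiff))
  have hQ := fun t (ht : t ≤ N) =>
    ((hQsm t ht).mdifferentiable (by simp) (fun i : Fin N => u i)).hasMFDerivAt
  have hX := fun t (ht : t ≤ N) =>
    ((hXsm t ht).contDiff.differentiable (by simp) (fun i : Fin N => u i)).hasFDerivAt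
  have hJ := fun t (ht : t < N) =>
    ((hcsm t ht).contDiff.differentiable (by simp) (fun i : Fin N => u i)).hasFDerivAt
  obtain ⟨ν, p, π, hν, hne, hle⟩ := hopt.exists_terminal_multiplier hs hf hc hU
    (hQ N le_rfl) (hX N le_rfl)
    (HasFDerivAt.fun_sum fun t ht => hJ t (Finset.mem_range.1 ht))
  rcases Nat.eq_zero_or_pos N with rfl | hN
  -- without any step all conditions except non-triviality are void, and `ν = -1` settles that one
  · exact ⟨0, 0, -1, Or.inl rfl, ⟨by simp, by omega, by simp⟩, by simp⟩
  -- `P t` is the costate at time `t`, a covector at `(q t, x t)`; `id` retypes `Dq`, a covector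
  -- at `q t`, as a functional on the model space
  obtain ⟨P, hPN, hP⟩ := exists_backward_recursion N (p, π) fun t a =>
    ((a.1.comp (mulRightTangent E (s t (q t) (x t)) (q t)) : E →L[ℝ] ℝ) +
      (id (Dq (hamiltonian O s f c ν) t (pullbackCovector O (q t) (s t (q t) (x t)) a.1) a.2
        (q t) (x t) (u t)) : E →L[ℝ] ℝ),
      Dx (hamiltonian O s f c ν) t (pullbackCovector O (q t) (s t (q t) (x t)) a.1) a.2
        (q t) (x t) (u t))
  let ζ : ℕ → (LieAlg E G →L[ℝ] ℝ) :=
    fun t => pullbackCovector O (q t) (s t (q t) (x t)) (P (t + 1)).1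
  have hp : ∀ t < N, ∀ y : E, (P t).1 y =
      (P (t + 1)).1 (mulRightTangent E (s t (q t) (x t)) (q t) y) +
        Dq (hamiltonian O s f c ν) t (ζ t) (P (t + 1)).2 (q t) (x t) (u t) y := by
    intro t ht y
    rw [hP t ht]
    rfl
  have hπ : ∀ t < N, (P t).2 =
      Dx (hamiltonian O s f c ν) t (ζ t) (P (t + 1)).2 (q t) (x t) (u t) := by
    intro t ht
    rw [hP t ht]
  have hstep : ∀ t < N, (lieExp (Dζ (hamiltonian O s f c ν) t (ζ t) (P (t + 1)).2
      (q t) (x t) (u t)) : G) = s t (q t) (x t) := by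
    intro t ht
    rw [Dζ_hamiltonian, lieExp_lieLog (hsO' t ht)]
  have hρ : ∀ t < N, coDerivLog O (lieExp (Dζ (hamiltonian O s f c ν) t (ζ t) (P (t + 1)).2
      (q t) (x t) (u t)) : G) (ζ t) =
        (P (t + 1)).1.comp (leftTangent (E := E) (q (t + 1)) : E →L[ℝ] E) := by
    intro t ht
    rw [hstep t ht, hadm.dyn_q t ht]
    exact coDerivLog_pullbackCovector hO (hsO' t ht) (q t) (P (t + 1)).1
  refine ⟨ζ, fun t => (P (t + 1)).2, ν, hν, ⟨fun t ht => ⟨?_, ?_⟩, fun t h1 ht => ⟨?_, ?_⟩,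
    fun t ht w hw => ?_⟩, ?_⟩
  · rw [hstep t ht]
    exact hadm.dyn_q t ht
  · rw [Dξ_hamiltonian]
    exact hadm.dyn_x t ht
  · obtain ⟨t, rfl⟩ := Nat.exists_eq_add_of_le' h1
    simp only [Nat.add_sub_cancel]
    rw [hρ t (by omega), hρ (t + 1) ht, lieExp_neg, hstep (t + 1) ht, hadm.dyn_q (t + 1) ht]
    have h2 := leftTangent_comp_Ad_inv (E := E) (q (t + 1)) (s (t + 1) (q (t + 1)) (x (t + 1)))
    ext y
    refine (hp (t + 1) ht _).trans ?_
    have h3 := DFunLike.congr_fun h2 y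
    exact congrArg (fun z : ℝ => z + _) (congrArg (P (t + 1 + 1)).1 h3.symm)
  · obtain ⟨t, rfl⟩ := Nat.exists_eq_add_of_le' h1
    exact hπ (t + 1) ht
  -- the variation of the control at the single time `t`
  · have h2 := hle (Function.update (fun i : Fin N => u i) ⟨t, ht⟩ w) (by
      intro i
      rcases eq_or_ne i ⟨t, ht⟩ with rfl | hi
      · simpa using hw
      · simpa [hi] using hadm.control i i.2)
    have h3 := hadm.sum_Du_hamiltonian hO hs hf hc hsO' hQ hX hJ ν (P := P) (ζ := ζ)
      (fun _ => rfl) hp hπ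
      (Function.update (fun i : Fin N => u i) ⟨t, ht⟩ w - fun i : Fin N => u i) N le_rfl
    rw [hPN] at h3
    rw [sum_apply, h3, Finset.sum_eq_single t] at h2
    · simpa [controlAt_apply ht] using h2
    · intro τ hτ hne
      have hτ := Finset.mem_range.1 hτ
      rw [controlAt_apply hτ, Pi.sub_apply, Function.update_of_ne (by simpa using hne), sub_self,
        map_zero]
    · intro h
      exact absurd (Finset.mem_range.2 ht) h
  -- the last costates determine the multipliers of the endpoint constraints
  · rintro ⟨hν0, h0⟩
    obtain ⟨h1, h2⟩ := h0 (N - 1) (by omega)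
    have h3 := eq_zero_of_pullbackCovector_eq_zero hO (hsO' (N - 1) (by omega)) h1
    rw [Nat.sub_add_cancel hN, hPN] at h3
    simp only [Nat.sub_add_cancel hN, hPN] at h2
    exact hne ⟨hν0, h3, h2⟩
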